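/- A generalized partition of an integer $n\ge 1$ is a finite multiset $\{(v_1,w_1),\dots,(v_k,w_k)\}$ of pairs of positive integers with $\sum_{i=1}^k v_iw_i=n$. Let $p_n$ be the number of generalized partitions of $n$, and let $q_n$ be the number of those with $\gcd(v_1,\dots,v_k)=1$. Let $d(\ell)$ denote the number of positive divisors of $\ell$, and for integers $m\ge -1$ and real $\omega>0$ let $$S_m(\omega)=\sum_{k\ge 1}\sum_{\ell\mid k}\ell\, d(\ell)\,k^m e^{-k/\omega}.$$ These series converge absolutely, and for every $n\ge 1$ the equation $S_0(\omega)=n$ has a unique solution $\omega=\omega(n)\in(0,\infty)$. As $n\to\infty$, $q_n\sim p_n$ and $$q_n\sim\frac{1}{\sqrt{2\pi S_1(\omega)}}\exp\left(S_{-1}(\omega)+\frac{n}{\omega}\right),\qquad \omega=\omega(n),$$ where $a_n\sim b_n$ means $\lim_{n\to\infty}a_n/b_n=1$. -/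

import Mathlib

namespace QuasiIdempotent

/-- Generalized partitions `v₁^{w₁} ⋯ v_k^{w_k}` of `n`: finite multisets of pairs `(v, w)` of
positive integers with `∑ vᵢ wᵢ = n`. (A multiset is a word `v^w` up to reordering its letters.) -/
def genPartitions (n : ℕ) : Set (Multiset (ℕ × ℕ)) :=
  {s | (∀ x ∈ s, 0 < x.1 ∧ 0 < x.2) ∧ (s.map fun x => x.1 * x.2).sum = n}

/-- Generalized partitions of `n` with `gcd (v₁, …, v_k) = 1`. -/
def primGenPartitions (n : ℕ) : Set (Multiset (ℕ × ℕ)) :=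
  {s | s ∈ genPartitions n ∧ (s.map Prod.fst).gcd = 1}

/-- There are finitely many generalized partitions of `n`, so the cardinalities below are genuine. -/
theorem genPartitions_finite (n : ℕ) : (genPartitions n).Finite := by
  classical
  let T : Finset (ℕ × ℕ) := Finset.range (n + 1) ×ˢ Finset.range (n + 1)
  refine (Set.finite_Iic (n • T.val)).subset ?_
  rintro s ⟨hpos, hsum⟩
  have hcard : s.card ≤ n := by
    have h : ∀ t : Multiset (ℕ × ℕ), (∀ x ∈ t, 0 < x.1 ∧ 0 < x.2) →
        t.card ≤ (t.map fun x => x.1 * x.2).sum := by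
      intro t
      induction t using Multiset.induction_on with
      | empty => simp
      | cons a t ih =>
        intro ht
        have h1 := ih fun x hx => ht x (Multiset.mem_cons_of_mem hx)
        have h2 := ht a (Multiset.mem_cons_self a t)
        have h3 := Nat.mul_pos h2.1 h2.2
        simp only [Multiset.card_cons, Multiset.map_cons, Multiset.sum_cons]
        omega
    exact hsum ▸ h s hpos
  rw [Set.mem_Iic, Multiset.le_iff_count]
  intro a
  by_cases ha : a ∈ s
  · have hle : a.1 * a.2 ≤ n := by
      rw [← hsum]
      exact Multiset.le_sum_of_mem (Multiset.mem_map_of_mem (fun x : ℕ × ℕ => x.1 * x.2) ha)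
    have h1 : a.1 ≤ n := (Nat.le_mul_of_pos_right _ (hpos a ha).2).trans hle
    have h2 : a.2 ≤ n := (Nat.le_mul_of_pos_left _ (hpos a ha).1).trans hle
    have hT : a ∈ T := by
      simp only [T, Finset.mem_product, Finset.mem_range]
      omega
    rw [Multiset.count_nsmul, Multiset.count_eq_one_of_mem T.nodup hT, mul_one]
    exact (Multiset.count_le_card a s).trans hcard
  · rw [Multiset.count_eq_zero_of_notMem ha]
    exact Nat.zero_le _

/-- `p_n`, the number of generalized partitions of `n`. -/
noncomputable def p (n : ℕ) : ℕ := (genPartitions n).ncard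

/-- `q_n`, the number of generalized partitions of `n` with greatest common divisor `1`. -/
noncomputable def q (n : ℕ) : ℕ := (primGenPartitions n).ncard

/-- The `k`-th term `∑_{ℓ ∣ k} ℓ d(ℓ) k^m e^{-k/ω}` of the series `S_m(ω)`, where `d(ℓ)` is the
number of divisors of `ℓ`. It vanishes for `k = 0`, since `Nat.divisors 0 = ∅`. -/
noncomputable def STerm (m : ℤ) (ω : ℝ) (k : ℕ) : ℝ :=
  ∑ l ∈ k.divisors, (l : ℝ) * (l.divisors.card : ℝ) * (k : ℝ) ^ m * Real.exp (-(k : ℝ) / ω)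

/-- `S_m(ω) = ∑_{k ≥ 1} ∑_{ℓ ∣ k} ℓ d(ℓ) k^m e^{-k/ω}`. -/
noncomputable def S (m : ℤ) (ω : ℝ) : ℝ := ∑' k : ℕ, STerm m ω k

end QuasiIdempotent

/-! ### Combinatorics: the recurrence for `p` and the comparison of `p` with `q`. -/

namespace QuasiIdempotent

/-! The proof is a saddle point argument. The generating function of `p` is the product of `(1 -
z^(v w))⁻¹` over all pairs, whose logarithm is `∑ (weight k / k) z^k`. No infinite product is
handled: double counting gives `mul_p_eq_sum`, which is the coefficient form of `G' = (log G)' G`,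
so `exp` of that power series has Taylor coefficients `p n` (`iteratedDeriv_gen`).

Cauchy's formula (`integral_gen_div_pow`) on the circle of radius `exp (-1/ω)` writes `p n` as `exp
(S₋₁ + n/ω)` times an integral of `exp (phase ω θ)`. The equation `S₀ ω = n` removes the linear term
of the phase, leaving `-S₁ θ²/2` with error at most `4 S₂ |θ|³` (`norm_phase_add_le`). For large `θ`
a comparison with the geometric series gives decay `exp (-κ √ω)` (`re_phase_le`,
`exists_re_phase_le_of_large`). Rescaling by `√S₁` and dominated convergence yield the Gaussian
integral (`tendsto_sqrt_mul_integral_exp_phase`), hence the formula for `p`.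

A partition whose gcd is `d ≥ 2` comes from a partition of `n / d` (`p_le_q_add_sum`). The trivial
bound `p_le_exp` at the same `ω` shows that these contribute less than the main term by a factor of
order `n √S₁ exp (-n/(2ω))`, which tends to `0`; so `q` inherits the asymptotics of `p`. -/

/-- The arithmetic function `k ↦ ∑_{ℓ ∣ k} ℓ d(ℓ)`. -/
def weight (k : ℕ) : ℕ := ∑ l ∈ k.divisors, l * l.divisors.card

/-- The size `∑ vᵢ wᵢ` of a multiset of pairs. -/
def size (s : Multiset (ℕ × ℕ)) : ℕ := (s.map fun x => x.1 * x.2).sum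

theorem mem_genPartitions {n : ℕ} {s : Multiset (ℕ × ℕ)} :
    s ∈ genPartitions n ↔ (∀ x ∈ s, 0 < x.1 ∧ 0 < x.2) ∧ size s = n := Iff.rfl

theorem size_add (s t : Multiset (ℕ × ℕ)) : size (s + t) = size s + size t := by
  simp [size]

theorem size_replicate (j : ℕ) (x : ℕ × ℕ) :
    size (Multiset.replicate j x) = j * (x.1 * x.2) := by
  simp [size]

theorem mul_le_size {s : Multiset (ℕ × ℕ)} {x : ℕ × ℕ} (hx : x ∈ s) : x.1 * x.2 ≤ size s :=
  Multiset.le_sum_of_mem (Multiset.mem_map_of_mem (fun x : ℕ × ℕ => x.1 * x.2) hx)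

/-- The generalized partitions of `n` as a finset. -/
noncomputable def genPartitionsFinset (n : ℕ) : Finset (Multiset (ℕ × ℕ)) :=
  (genPartitions_finite n).toFinset

theorem mem_genPartitionsFinset {n : ℕ} {s : Multiset (ℕ × ℕ)} :
    s ∈ genPartitionsFinset n ↔ (∀ x ∈ s, 0 < x.1 ∧ 0 < x.2) ∧ size s = n := by
  rw [genPartitionsFinset, Set.Finite.mem_toFinset, mem_genPartitions]

theorem card_genPartitionsFinset (n : ℕ) : (genPartitionsFinset n).card = p n :=
  (Set.ncard_eq_toFinset_card _ _).symm

/-- Removing `j` copies of `x` identifies the generalized partitions containing `x` at least `j`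
times with generalized partitions of a smaller number. -/
theorem card_filter_le_count (n j : ℕ) {x : ℕ × ℕ} (hx : 0 < x.1 ∧ 0 < x.2) :
    ((genPartitionsFinset n).filter fun s => j ≤ s.count x).card =
      if x.1 * x.2 * j ≤ n then p (n - x.1 * x.2 * j) else 0 := by
  classical
  split_ifs with h
  · rw [← card_genPartitionsFinset]
    symm
    refine Finset.card_bij' (fun s _ => s + Multiset.replicate j x)
      (fun s _ => s - Multiset.replicate j x) ?_ ?_ ?_ ?_
    · intro s hs
      rw [mem_genPartitionsFinset] at hs
      rw [Finset.mem_filter, mem_genPartitionsFinset]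
      refine ⟨⟨fun y hy => ?_, ?_⟩, by simp⟩
      · rcases Multiset.mem_add.1 hy with hy | hy
        · exact hs.1 y hy
        · rw [Multiset.eq_of_mem_replicate hy]; exact hx
      · rw [size_add, size_replicate, hs.2, mul_comm j]; omega
    · intro s hs
      rw [Finset.mem_filter, mem_genPartitionsFinset] at hs
      rw [mem_genPartitionsFinset]
      have hle : Multiset.replicate j x ≤ s := Multiset.le_count_iff_replicate_le.1 hs.2
      refine ⟨fun y hy => hs.1.1 y (Multiset.mem_of_le (Multiset.sub_le_self _ _) hy), ?_⟩
      have h1 := size_add (s - Multiset.replicate j x) (Multiset.replicate j x)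
      rw [Multiset.sub_add_cancel hle, hs.1.2, size_replicate, mul_comm j] at h1
      omega
    · intro s _
      simp
    · intro s hs
      rw [Finset.mem_filter] at hs
      exact Multiset.sub_add_cancel (Multiset.le_count_iff_replicate_le.1 hs.2)
  · rw [Finset.card_eq_zero, Finset.filter_eq_empty_iff]
    intro s hs hj
    rw [mem_genPartitionsFinset] at hs
    have hle : Multiset.replicate j x ≤ s := Multiset.le_count_iff_replicate_le.1 hj
    have h1 := size_add (s - Multiset.replicate j x) (Multiset.replicate j x)
    rw [Multiset.sub_add_cancel hle, hs.2, size_replicate, mul_comm j] at h1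
    omega

theorem sum_filter_mul_le (n : ℕ) (F : ℕ → ℕ → ℕ) :
    ∑ x ∈ (Finset.Icc 1 n ×ˢ Finset.Icc 1 n) with x.1 * x.2 ≤ n, F x.1 x.2 =
      ∑ k ∈ Finset.Icc 1 n, ∑ x ∈ k.divisorsAntidiagonal, F x.1 x.2 := by
  rw [← Finset.sum_fiberwise_of_maps_to (t := Finset.Icc 1 n) (g := fun x => x.1 * x.2)]
  · refine Finset.sum_congr rfl fun k hk => Finset.sum_congr ?_ fun _ _ => rfl
    ext ⟨a, b⟩
    simp only [Finset.mem_filter, Finset.mem_product, Finset.mem_Icc,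
      Nat.mem_divisorsAntidiagonal] at hk ⊢
    constructor
    · rintro ⟨_, h⟩
      exact ⟨h, by omega⟩
    · rintro ⟨h, _⟩
      have ha : 0 < a := Nat.pos_of_ne_zero fun h0 => by subst h0; omega
      have hb : 0 < b := Nat.pos_of_ne_zero fun h0 => by subst h0; omega
      have h1 := Nat.le_mul_of_pos_right a hb
      have h2 := Nat.le_mul_of_pos_left b ha
      omega
  · rintro ⟨a, b⟩ h
    simp only [Finset.mem_filter, Finset.mem_product, Finset.mem_Icc] at h ⊢
    have := Nat.mul_pos h.1.1.1 h.1.2.1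
    omega

theorem size_eq_sum_count {n : ℕ} {s : Multiset (ℕ × ℕ)} (hs : s ∈ genPartitionsFinset n) :
    n = ∑ x ∈ Finset.Icc 1 n ×ˢ Finset.Icc 1 n, s.count x * (x.1 * x.2) := by
  classical
  rw [mem_genPartitionsFinset] at hs
  conv_lhs => rw [← hs.2, size, Finset.sum_multiset_map_count]
  simp only [smul_eq_mul]
  refine Finset.sum_subset ?_ ?_
  · intro x hx
    rw [Multiset.mem_toFinset] at hx
    have h := hs.1 x hx
    have h0 := mul_le_size hx
    have h1 := Nat.le_mul_of_pos_right x.1 h.2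
    have h2 := Nat.le_mul_of_pos_left x.2 h.1
    rw [hs.2] at h0
    simp only [Finset.mem_product, Finset.mem_Icc]
    omega
  · intro x _ hx
    rw [Multiset.mem_toFinset] at hx
    simp [Multiset.count_eq_zero_of_notMem hx]

/-- A multiplicity is the number of `j ≥ 1` not exceeding it; exchanging the sums leaves the counts
of partitions containing `x` at least `j` times. -/
theorem sum_count_eq (n : ℕ) {x : ℕ × ℕ} (hx : 0 < x.1 ∧ 0 < x.2) :
    ∑ s ∈ genPartitionsFinset n, s.count x =
      ∑ j ∈ Finset.Icc 1 n, if x.1 * x.2 * j ≤ n then p (n - x.1 * x.2 * j) else 0 := by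
  classical
  simp_rw [← card_filter_le_count n _ hx, Finset.card_filter]
  rw [Finset.sum_comm]
  refine Finset.sum_congr rfl fun s hs => ?_
  rw [← Finset.card_filter]
  have hle : s.count x ≤ n := by
    by_contra! hlt
    have h1 := card_filter_le_count n (n + 1) hx
    rw [if_neg] at h1
    · rw [Finset.card_eq_zero, Finset.filter_eq_empty_iff] at h1
      exact h1 hs hlt
    · have := Nat.le_mul_of_pos_left (n + 1) (Nat.mul_pos hx.1 hx.2)
      omega
  have : (Finset.Icc 1 n).filter (fun j => j ≤ s.count x) = Finset.Icc 1 (s.count x) := by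
    ext j
    simp only [Finset.mem_filter, Finset.mem_Icc]
    omega
  rw [this, Nat.card_Icc, Nat.add_sub_cancel]

/-- The recurrence `n p_n = ∑_{k=1}^n (∑_{ℓ ∣ k} ℓ d(ℓ)) p_{n-k}`. -/
theorem mul_p_eq_sum (n : ℕ) : n * p n = ∑ k ∈ Finset.Icc 1 n, weight k * p (n - k) := by
  classical
  -- Double counting: each of the `p n` partitions has total size `n`, distributed over its pairs.
  have h1 : n * p n = ∑ s ∈ genPartitionsFinset n,
      ∑ x ∈ Finset.Icc 1 n ×ˢ Finset.Icc 1 n, s.count x * (x.1 * x.2) := by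
    rw [← Finset.sum_congr rfl fun s hs => size_eq_sum_count hs, Finset.sum_const,
      card_genPartitionsFinset, smul_eq_mul, mul_comm]
  -- `N l` counts the occurrences, over all partitions of `n`, of one fixed pair with product `l`;
  -- it depends on the pair only through `l`.
  set N : ℕ → ℕ := fun l => ∑ j ∈ Finset.Icc 1 n, if l * j ≤ n then p (n - l * j) else 0 with hN
  have hN0 : ∀ l, n < l → N l = 0 := by
    intro l hl
    refine Finset.sum_eq_zero fun j hj => if_neg ?_
    have := Nat.le_mul_of_pos_right l (Finset.mem_Icc.1 hj).1
    omega
  have h2 : n * p n = ∑ x ∈ Finset.Icc 1 n ×ˢ Finset.Icc 1 n, N (x.1 * x.2) * (x.1 * x.2) := by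
    rw [h1, Finset.sum_comm]
    refine Finset.sum_congr rfl fun x hx => ?_
    simp only [Finset.mem_product, Finset.mem_Icc] at hx
    rw [← Finset.sum_mul, sum_count_eq n ⟨hx.1.1, hx.2.1⟩]
  rw [h2, ← Finset.sum_filter_of_ne (p := fun x => x.1 * x.2 ≤ n),
    sum_filter_mul_le n fun a b => N (a * b) * (a * b)]
  -- There are `d(l)` pairs with product `l`, which produces the factor `l d(l)`; regrouping by `k =
  -- l j` then produces `weight k`.
  · have h3 : ∀ l ∈ Finset.Icc 1 n,
        ∑ x ∈ l.divisorsAntidiagonal, N (x.1 * x.2) * (x.1 * x.2) =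
        ∑ j ∈ Finset.Icc 1 n,
          if l * j ≤ n then l * l.divisors.card * p (n - l * j) else 0 := by
      intro l _
      have : ∀ x ∈ l.divisorsAntidiagonal, N (x.1 * x.2) * (x.1 * x.2) = N l * l := by
        intro x hx
        rw [(Nat.mem_divisorsAntidiagonal.1 hx).1]
      rw [Finset.sum_congr rfl this, Finset.sum_const, smul_eq_mul,
        ← Nat.map_div_right_divisors, Finset.card_map, hN]
      simp only [Finset.sum_mul, Finset.mul_sum]
      refine Finset.sum_congr rfl fun j _ => ?_
      split_ifs <;> ring
    rw [Finset.sum_congr rfl h3, ← Finset.sum_product', ← Finset.sum_filter,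
      sum_filter_mul_le n fun l j => l * l.divisors.card * p (n - l * j)]
    refine Finset.sum_congr rfl fun k _ => ?_
    rw [weight, Finset.sum_mul, Nat.sum_divisorsAntidiagonal
      (f := fun l j => l * l.divisors.card * p (n - l * j))]
    refine Finset.sum_congr rfl fun l hl => ?_
    rw [Nat.mul_div_cancel' (Nat.dvd_of_mem_divisors hl)]
  · intro x _ hx
    by_contra! hlt
    exact hx (by rw [hN0 _ hlt, zero_mul])

theorem p_zero : p 0 = 1 := by
  have : genPartitions 0 = {0} := by
    ext s
    rw [mem_genPartitions, Set.mem_singleton_iff]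
    constructor
    · rintro ⟨h, hs⟩
      refine Multiset.eq_zero_of_forall_notMem fun x hx => ?_
      have h1 := mul_le_size hx
      have h2 := Nat.mul_pos (h x hx).1 (h x hx).2
      omega
    · rintro rfl
      simp [size]
  rw [p, this, Set.ncard_singleton]

/-- A generalized partition with nontrivial greatest common divisor is a multiple of a generalized
partition of a proper divisor. -/
theorem p_le_q_add_sum {n : ℕ} (hn : 1 ≤ n) :
    p n ≤ q n + ∑ d ∈ Finset.Icc 2 n, p (n / d) := by
  classical
  have hsub : genPartitionsFinset n ⊆
      (genPartitionsFinset n).filter (fun s => (s.map Prod.fst).gcd = 1) ∪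
        (Finset.Icc 2 n).biUnion fun d =>
          (genPartitionsFinset (n / d)).image fun s => s.map fun x => (d * x.1, x.2) := by
    intro s hs
    have hs' := mem_genPartitionsFinset.1 hs
    by_cases h1 : (s.map Prod.fst).gcd = 1
    · exact Finset.mem_union_left _ (Finset.mem_filter.2 ⟨hs, h1⟩)
    refine Finset.mem_union_right _ (Finset.mem_biUnion.2 ⟨(s.map Prod.fst).gcd, ?_, ?_⟩)
    · obtain ⟨x, hx⟩ : ∃ x, x ∈ s := Multiset.exists_mem_of_ne_zero (by
        rintro rfl
        have := hs'.2
        simp [size] at this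
        omega)
      have hdvd : (s.map Prod.fst).gcd ∣ x.1 := Multiset.gcd_dvd (Multiset.mem_map_of_mem _ hx)
      have hpos := hs'.1 x hx
      have h2 := Nat.le_of_dvd hpos.1 hdvd
      have h3 := Nat.pos_of_dvd_of_pos hdvd hpos.1
      have h4 := mul_le_size hx
      have h5 := Nat.le_mul_of_pos_right x.1 hpos.2
      rw [hs'.2] at h4
      rw [Finset.mem_Icc]
      omega
    · set d := (s.map Prod.fst).gcd with hd
      have hdvd : ∀ x ∈ s, d ∣ x.1 := fun x hx => Multiset.gcd_dvd (Multiset.mem_map_of_mem _ hx)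
      have hback : (s.map fun x => (x.1 / d, x.2)).map (fun x => (d * x.1, x.2)) = s := by
        rw [Multiset.map_map]
        conv_rhs => rw [← Multiset.map_id s]
        refine Multiset.map_congr rfl fun x hx => ?_
        simp [Nat.mul_div_cancel' (hdvd x hx)]
      have hsize : ∀ t : Multiset (ℕ × ℕ), size (t.map fun x => (d * x.1, x.2)) = d * size t := by
        intro t
        simp only [size, Multiset.map_map, Function.comp_def, mul_assoc, Multiset.sum_map_mul_left]
      -- If the gcd were `0`, the size `n` would vanish.
      have hdpos : 0 < d := by
        rcases Nat.eq_zero_or_pos d with h0 | h0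
        · have := hsize (s.map fun x => (x.1 / d, x.2))
          rw [hback, hs'.2, h0, zero_mul] at this
          omega
        · exact h0
      refine Finset.mem_image.2 ⟨s.map fun x => (x.1 / d, x.2), ?_, hback⟩
      rw [mem_genPartitionsFinset]
      constructor
      · intro y hy
        obtain ⟨x, hx, rfl⟩ := Multiset.mem_map.1 hy
        have hpos := hs'.1 x hx
        exact ⟨Nat.div_pos (Nat.le_of_dvd hpos.1 (hdvd x hx)) hdpos, hpos.2⟩
      · rw [← hs'.2]
        conv_rhs => rw [← hback, hsize, Nat.mul_div_cancel_left _ hdpos]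
  have hq : ((genPartitionsFinset n).filter (fun s => (s.map Prod.fst).gcd = 1)).card = q n := by
    rw [q, ← Set.ncard_coe_finset]
    congr 1
    ext s
    simp only [Finset.coe_filter, mem_genPartitionsFinset, primGenPartitions, Set.mem_ofPred_eq,
      mem_genPartitions]
  rw [← card_genPartitionsFinset, ← hq]
  refine (Finset.card_le_card hsub).trans ((Finset.card_union_le _ _).trans ?_)
  refine Nat.add_le_add_left (Finset.card_biUnion_le.trans (Finset.sum_le_sum fun d _ => ?_)) _
  rw [← card_genPartitionsFinset]
  exact Finset.card_image_le

theorem q_le_p (n : ℕ) : q n ≤ p n :=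
  Set.ncard_le_ncard (fun _ h => h.1) (genPartitions_finite n)

end QuasiIdempotent

/-! ### The series `S m`: convergence, size, and the saddle point equation. -/

namespace QuasiIdempotent

theorem STerm_eq (m : ℤ) (ω : ℝ) (k : ℕ) :
    STerm m ω k = (weight k : ℝ) * (k : ℝ) ^ m * Real.exp (-(k : ℝ) / ω) := by
  rw [STerm, weight]
  push_cast
  rw [Finset.sum_mul, Finset.sum_mul]

theorem STerm_nonneg (m : ℤ) (ω : ℝ) (k : ℕ) : 0 ≤ STerm m ω k := by
  rw [STerm_eq]
  positivity

theorem weight_zero : weight 0 = 0 := by simp [weight]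

theorem le_weight (k : ℕ) : k ≤ weight k := by
  rcases Nat.eq_zero_or_pos k with rfl | hk
  · exact Nat.zero_le _
  · have hmem : k ∈ k.divisors := Nat.mem_divisors_self k hk.ne'
    calc k ≤ k * k.divisors.card := Nat.le_mul_of_pos_right _ (Finset.card_pos.2 ⟨k, hmem⟩)
      _ ≤ weight k := Finset.single_le_sum (f := fun l => l * l.divisors.card)
          (fun _ _ => Nat.zero_le _) hmem

open LSeries.notation in
-- Each of the `d(l)` factorizations `a b = l` contributes `l`, so `l d(l)` is the convolution of
-- the identity with itself, and summing over divisors convolves with `1`.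
theorem weight_eq_convolution (k : ℕ) :
    (((fun n : ℕ => (n : ℂ)) ⍟ (fun n : ℕ => (n : ℂ))) ⍟ (1 : ℕ → ℂ)) k = (weight k : ℂ) := by
  rw [LSeries.convolution_def, weight]
  simp only [Pi.one_apply, mul_one]
  rw [Nat.sum_divisorsAntidiagonal
    (f := fun l _ => ((fun n : ℕ => (n : ℂ)) ⍟ (fun n : ℕ => (n : ℂ))) l)]
  push_cast
  refine Finset.sum_congr rfl fun l _ => ?_
  rw [LSeries.convolution_def]
  have : ∀ x ∈ l.divisorsAntidiagonal, (x.1 : ℂ) * (x.2 : ℂ) = l := by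
    intro x hx
    exact_mod_cast (Nat.mem_divisorsAntidiagonal.1 hx).1
  simp only
  rw [Finset.sum_congr rfl this, Finset.sum_const, nsmul_eq_mul, mul_comm,
    ← Nat.map_div_right_divisors, Finset.card_map]

/-- Convergence of `ζ(s) ζ(s-1)² = ∑ weight(k) k^{-s}` at a real point `s > 2`. -/
theorem summable_weight_mul_rpow {s : ℝ} (hs : 2 < s) :
    Summable fun k : ℕ => (weight k : ℝ) * (k : ℝ) ^ (-s) := by
  have hid : LSeriesSummable (fun n : ℕ => (n : ℂ)) (s : ℂ) := by
    refine LSeriesSummable_of_le_const_mul_rpow (x := 2) (by simpa using hs) ⟨1, fun n _ => ?_⟩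
    norm_num
  have hone : LSeriesSummable (1 : ℕ → ℂ) (s : ℂ) :=
    LSeriesSummable_one_iff.2 (by simp; linarith)
  have h := ((hid.convolution hid).convolution hone).norm
  refine h.congr fun k => ?_
  rcases Nat.eq_zero_or_pos k with rfl | hk
  · simp [weight_zero]
  · rw [LSeries.norm_term_eq, if_neg hk.ne', weight_eq_convolution, Real.rpow_neg (Nat.cast_nonneg k)]
    simp [div_eq_mul_inv]

/-- This is `t ≤ exp t` at `t = x / a`, raised to the power `a`. -/
theorem exp_neg_le_rpow {a x : ℝ} (ha : 0 < a) (hx : 0 < x) :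
    Real.exp (-x) ≤ a ^ a * x ^ (-a) := by
  have h1 : x / a ≤ Real.exp (x / a) := by linarith [Real.add_one_le_exp (x / a)]
  have h2 : (x / a) ^ a ≤ Real.exp x := by
    calc (x / a) ^ a ≤ Real.exp (x / a) ^ a := Real.rpow_le_rpow (by positivity) h1 ha.le
      _ = Real.exp x := by rw [← Real.exp_mul, div_mul_cancel₀ _ ha.ne']
  rw [Real.div_rpow hx.le ha.le, div_le_iff₀ (by positivity)] at h2
  rw [Real.exp_neg, Real.rpow_neg hx.le, ← div_eq_mul_inv, inv_eq_one_div,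
    div_le_div_iff₀ (Real.exp_pos x) (by positivity)]
  linarith

/-- The exponential is traded for the power of `k` that leaves the convergent series at `9/4 = 2 +
ε`. Convergence needs `ε > 0`; the later estimates of the cubic error and of the far arc need `ε <
1/2`. -/
theorem STerm_le {m : ℤ} (hm : -1 ≤ m) {ω : ℝ} (hω : 0 < ω) (k : ℕ) :
    STerm m ω k ≤ ((m : ℝ) + 9 / 4) ^ ((m : ℝ) + 9 / 4) * ω ^ ((m : ℝ) + 9 / 4) *
      ((weight k : ℝ) * (k : ℝ) ^ (-(9 / 4) : ℝ)) := by
  rw [STerm_eq]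
  rcases Nat.eq_zero_or_pos k with rfl | hk
  · simp [weight_zero]
  have hm' : (-1 : ℝ) ≤ m := by exact_mod_cast hm
  have hk' : (0 : ℝ) < k := by exact_mod_cast hk
  set a : ℝ := (m : ℝ) + 9 / 4 with ha
  have h1 := exp_neg_le_rpow (a := a) (by linarith) (div_pos hk' hω)
  have h2 : ((k : ℝ) / ω) ^ (-a) = (k : ℝ) ^ (-a) * ω ^ a := by
    rw [Real.div_rpow hk'.le hω.le, Real.rpow_neg hω.le, div_inv_eq_mul]
  have h3 : (k : ℝ) ^ m * (k : ℝ) ^ (-a) = (k : ℝ) ^ (-(9 / 4) : ℝ) := by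
    rw [← Real.rpow_intCast, ← Real.rpow_add hk']
    congr 1
    rw [ha]; ring
  calc (weight k : ℝ) * (k : ℝ) ^ m * Real.exp (-(k : ℝ) / ω)
      ≤ (weight k : ℝ) * (k : ℝ) ^ m * (a ^ a * ((k : ℝ) / ω) ^ (-a)) := by
        rw [neg_div]
        gcongr
    _ = a ^ a * ω ^ a * ((weight k : ℝ) * ((k : ℝ) ^ m * (k : ℝ) ^ (-a))) := by rw [h2]; ring
    _ = _ := by rw [h3]

theorem summable_STerm {m : ℤ} (hm : -1 ≤ m) {ω : ℝ} (hω : 0 < ω) : Summable (STerm m ω) :=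
  Summable.of_nonneg_of_le (STerm_nonneg m ω) (STerm_le hm hω)
    ((summable_weight_mul_rpow (by norm_num)).mul_left _)

/-- `S_m(ω) = O(ω^{m + 9/4})`, uniformly in `ω > 0`. -/
theorem exists_S_le {m : ℤ} (hm : -1 ≤ m) :
    ∃ C : ℝ, 0 < C ∧ ∀ ω : ℝ, 0 < ω → S m ω ≤ C * ω ^ ((m : ℝ) + 9 / 4) := by
  have hs := summable_weight_mul_rpow (s := 9 / 4) (by norm_num)
  have hm' : (-1 : ℝ) ≤ m := by exact_mod_cast hm
  have hnn : 0 ≤ ∑' k : ℕ, (weight k : ℝ) * (k : ℝ) ^ (-(9 / 4) : ℝ) :=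
    tsum_nonneg fun k => by positivity
  have ha : 0 < (m : ℝ) + 9 / 4 := by linarith
  refine ⟨((m : ℝ) + 9 / 4) ^ ((m : ℝ) + 9 / 4) *
    (∑' k : ℕ, (weight k : ℝ) * (k : ℝ) ^ (-(9 / 4) : ℝ) + 1), by positivity, fun ω hω => ?_⟩
  have h := (summable_STerm hm hω).tsum_le_tsum (STerm_le hm hω) (hs.mul_left _)
  rw [tsum_mul_left] at h
  refine h.trans ?_
  have : 0 ≤ ((m : ℝ) + 9 / 4) ^ ((m : ℝ) + 9 / 4) * ω ^ ((m : ℝ) + 9 / 4) := by positivity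
  linarith

/-- `S_m(ω) ≥ e⁻⁴ ω^{m+2}` for `ω ≥ 1`. -/
theorem le_S (m : ℕ) {ω : ℝ} (hω : 1 ≤ ω) : Real.exp (-4) * ω ^ (m + 2) ≤ S m ω := by
  have hω0 : 0 < ω := by linarith
  set N := ⌈ω⌉₊ with hN
  have hN1 : ω ≤ N := Nat.le_ceil ω
  have hN2 : (N : ℝ) ≤ 2 * ω := by linarith [(Nat.ceil_lt_add_one hω0.le).le]
  -- On this window `ω ≤ k ≤ 4ω`, so `exp (-k/ω) ≥ exp (-4)`, and it contains `N ≥ ω` terms.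
  have hterm : ∀ k ∈ Finset.Ioc N (2 * N), Real.exp (-4) * ω ^ (m + 1) ≤ STerm m ω k := by
    intro k hk
    rw [Finset.mem_Ioc] at hk
    have hk1 : (N : ℝ) ≤ k := by exact_mod_cast hk.1.le
    have hk2 : (k : ℝ) ≤ 2 * N := by exact_mod_cast hk.2
    have hw : (k : ℝ) ≤ weight k := by exact_mod_cast le_weight k
    rw [STerm_eq, zpow_natCast]
    have h1 : ω ^ (m + 1) ≤ (weight k : ℝ) * (k : ℝ) ^ m := by
      rw [pow_succ, mul_comm]
      gcongr
      · linarith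
      · linarith
    have h2 : Real.exp (-4) ≤ Real.exp (-(k : ℝ) / ω) := by
      apply Real.exp_le_exp.2
      rw [neg_div, neg_le_neg_iff, div_le_iff₀ hω0]
      linarith
    rw [mul_comm]
    gcongr
  have hsum := Finset.card_nsmul_le_sum _ _ _ hterm
  have hcard : (Finset.Ioc N (2 * N)).card = N := by simp; omega
  rw [hcard, nsmul_eq_mul] at hsum
  calc Real.exp (-4) * ω ^ (m + 2) = ω * (Real.exp (-4) * ω ^ (m + 1)) := by ring
    _ ≤ N * (Real.exp (-4) * ω ^ (m + 1)) := by gcongr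
    _ ≤ ∑ k ∈ Finset.Ioc N (2 * N), STerm m ω k := hsum
    _ ≤ S m ω := (summable_STerm (by omega) hω0).sum_le_tsum _ fun k _ => STerm_nonneg m ω k

theorem STerm_mono (m : ℤ) (k : ℕ) {ω₁ ω₂ : ℝ} (h0 : 0 < ω₁) (h : ω₁ ≤ ω₂) :
    STerm m ω₁ k ≤ STerm m ω₂ k := by
  simp only [STerm_eq, neg_div]
  gcongr

theorem S_zero_strictMonoOn : StrictMonoOn (S 0) (Set.Ioi 0) := by
  intro ω₁ h1 ω₂ h2 h
  rw [Set.mem_Ioi] at h1 h2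
  refine Summable.tsum_lt_tsum (i := 1) (fun k => STerm_mono 0 k h1 h.le) ?_
    (summable_STerm (by norm_num) h1) (summable_STerm (by norm_num) h2)
  have hw : (1 : ℝ) ≤ weight 1 := by exact_mod_cast le_weight 1
  simp only [STerm_eq, neg_div]
  have : Real.exp (-((1 : ℕ) / ω₁)) < Real.exp (-((1 : ℕ) / ω₂)) := by
    apply Real.exp_lt_exp.2
    rw [neg_lt_neg_iff]
    push_cast
    exact one_div_lt_one_div_of_lt h1 h
  have h3 : (0 : ℝ) < (weight 1 : ℝ) * ((1 : ℕ) : ℝ) ^ (0 : ℤ) := by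
    rw [zpow_zero, mul_one]; linarith
  exact mul_lt_mul_of_pos_left this h3

theorem S_zero_continuousOn {ω₁ ω₂ : ℝ} (h0 : 0 < ω₁) (h : ω₁ ≤ ω₂) :
    ContinuousOn (S 0) (Set.Icc ω₁ ω₂) := by
  refine continuousOn_tsum (u := STerm 0 ω₂) (fun k => ?_)
    (summable_STerm (by norm_num) (h0.trans_le h)) ?_
  · have : ∀ ω ∈ Set.Icc ω₁ ω₂, ω ≠ 0 := fun ω hω => (h0.trans_le hω.1).ne'
    simp only [funext fun ω => STerm_eq 0 ω k]
    exact continuousOn_const.mul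
      (Real.continuous_exp.comp_continuousOn (continuousOn_const.div continuousOn_id this))
  · intro k ω hω
    rw [Real.norm_of_nonneg (STerm_nonneg _ _ _)]
    exact STerm_mono 0 k (h0.trans_le hω.1) hω.2

theorem existsUnique_saddle {n : ℕ} (hn : 1 ≤ n) : ∃! ω : ℝ, 0 < ω ∧ S 0 ω = (n : ℝ) := by
  have hn' : (1 : ℝ) ≤ n := by exact_mod_cast hn
  obtain ⟨C, hC, hle⟩ := exists_S_le (m := 0) (by norm_num)
  -- Chosen so that the upper bound `C ω₁^(9/4)` equals `1 ≤ n`.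
  set ω₁ : ℝ := (C⁻¹ : ℝ) ^ ((4 : ℝ) / 9) with hω₁
  have hpos1 : 0 < ω₁ := by positivity
  have h1 : S 0 ω₁ ≤ n := by
    refine (hle ω₁ hpos1).trans ?_
    rw [hω₁, ← Real.rpow_mul (by positivity)]
    norm_num
    rw [mul_inv_cancel₀ hC.ne']
    exact hn'
  -- Large enough for the lower bound `exp (-4) ω₂²` to reach `n`.
  set ω₂ : ℝ := max ω₁ (Real.exp 4 * n) with hω₂
  have hbig : Real.exp 4 * n ≤ ω₂ := le_max_right _ _
  have he : (1 : ℝ) ≤ Real.exp 4 := Real.one_le_exp (by norm_num)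
  have hone : 1 ≤ ω₂ := le_trans (by nlinarith) hbig
  have h2 : (n : ℝ) ≤ S 0 ω₂ := by
    have h3 := le_S 0 hone
    rw [Nat.cast_zero] at h3
    refine le_trans ?_ h3
    calc (n : ℝ) = Real.exp (-4) * (Real.exp 4 * n) := by
          rw [← mul_assoc, ← Real.exp_add]; simp
      _ ≤ Real.exp (-4) * ω₂ ^ (0 + 2) := by
          gcongr
          exact hbig.trans (le_self_pow₀ hone (by norm_num))
  obtain ⟨ω, hω, hS⟩ := intermediate_value_Icc (le_max_left _ _)
    (S_zero_continuousOn hpos1 (le_max_left _ _)) ⟨h1, h2⟩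
  refine ⟨ω, ⟨hpos1.trans_le hω.1, hS⟩, fun ω' h' => ?_⟩
  exact S_zero_strictMonoOn.injOn h'.1 (hpos1.trans_le hω.1) (h'.2.trans hS.symm)

/-- Any choice of solutions of `S₀(ω) = n` tends to infinity with `n`. -/
theorem tendsto_saddle {ω : ℕ → ℝ} (hω : ∀ n : ℕ, 1 ≤ n → 0 < ω n ∧ S 0 (ω n) = (n : ℝ)) :
    Filter.Tendsto ω Filter.atTop Filter.atTop := by
  rw [Filter.tendsto_atTop]
  intro b
  set b' := max b 1
  filter_upwards [Filter.eventually_ge_atTop 1,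
    (tendsto_natCast_atTop_atTop (R := ℝ)).eventually_ge_atTop (S 0 b')] with n hn hb
  rw [← (hω n hn).2] at hb
  have hb0 : (0 : ℝ) < b' := lt_of_lt_of_le one_pos (le_max_right _ _)
  exact (le_max_left b 1).trans ((S_zero_strictMonoOn.le_iff_le hb0 (hω n hn).1).1 hb)

end QuasiIdempotent

/-! ### The generating function and Cauchy's formula. -/

namespace QuasiIdempotent

open scoped Topology

/-- The logarithm `∑ (weight k / k) z^k` of the generating function of `p`. -/
noncomputable def logGen (z : ℂ) : ℂ := ∑' k : ℕ, ((weight k : ℂ) / (k : ℂ)) * z ^ k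

theorem norm_logGen_term (ω : ℝ) {z : ℂ} (hz : ‖z‖ = Real.exp (-1 / ω)) (k : ℕ) :
    ‖((weight k : ℂ) / (k : ℂ)) * z ^ k‖ = STerm (-1) ω k := by
  rw [STerm_eq, norm_mul, norm_pow, hz, ← Real.exp_nat_mul, zpow_neg_one, norm_div,
    Complex.norm_natCast, Complex.norm_natCast, div_eq_mul_inv]
  congr 2
  ring

theorem summable_norm_logGen {z : ℂ} (hz : ‖z‖ < 1) :
    Summable fun k : ℕ => ‖((weight k : ℂ) / (k : ℂ)) * z ^ k‖ := by
  rcases eq_or_ne z 0 with rfl | h0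
  · refine summable_of_ne_finset_zero (s := {0}) fun k hk => ?_
    rw [Finset.mem_singleton] at hk
    simp [hk]
  · have hlog : Real.log ‖z‖ < 0 := Real.log_neg (norm_pos_iff.2 h0) hz
    have h1 : ‖z‖ = Real.exp (-1 / (-1 / Real.log ‖z‖)) := by
      rw [div_div_cancel₀ (by norm_num), Real.exp_log (norm_pos_iff.2 h0)]
    simp_rw [norm_logGen_term _ h1]
    exact summable_STerm (by norm_num) (div_pos_of_neg_of_neg (by norm_num) hlog)

theorem hasFPowerSeriesOnBall_logGen :
    HasFPowerSeriesOnBall logGen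
      (FormalMultilinearSeries.ofScalars ℂ fun k : ℕ => (weight k : ℂ) / (k : ℂ)) 0 1 := by
  set P := FormalMultilinearSeries.ofScalars ℂ fun k : ℕ => (weight k : ℂ) / (k : ℂ) with hP
  have hrad : 1 ≤ P.radius := by
    refine ENNReal.le_of_forall_nnreal_lt fun r hr => ?_
    have hr' : (r : ℝ) < 1 := by exact_mod_cast hr
    refine P.le_radius_of_summable ?_
    refine (summable_norm_logGen (z := (r : ℂ)) (by simpa using hr')).congr fun k => ?_
    rw [norm_mul, hP, FormalMultilinearSeries.ofScalars_norm]
    simp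
  have hsum : P.sum = logGen := by
    funext z
    simp only [FormalMultilinearSeries.sum, hP, FormalMultilinearSeries.ofScalars_apply_eq,
      smul_eq_mul, logGen]
  rw [← hsum]
  exact (P.hasFPowerSeriesOnBall (lt_of_lt_of_le one_pos hrad)).mono one_pos hrad

theorem iteratedDeriv_logGen (n : ℕ) :
    iteratedDeriv n logGen 0 = (n.factorial : ℂ) * ((weight n : ℂ) / (n : ℂ)) := by
  have h := hasFPowerSeriesOnBall_logGen.factorial_smul 1 n
  rw [iteratedFDeriv_apply_eq_iteratedDeriv_mul_prod, Finset.prod_const_one, one_smul] at h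
  rw [← h, FormalMultilinearSeries.ofScalars_apply_eq]
  simp

theorem mem_unitDisc {z : ℂ} : z ∈ Metric.eball (0 : ℂ) 1 ↔ ‖z‖ < 1 := by
  rw [Metric.mem_eball, edist_zero_right, ← ofReal_norm, ENNReal.ofReal_lt_one]

theorem analyticAt_logGen {z : ℂ} (hz : ‖z‖ < 1) : AnalyticAt ℂ logGen z :=
  hasFPowerSeriesOnBall_logGen.analyticAt_of_mem (mem_unitDisc.2 hz)

theorem logGen_zero : logGen 0 = 0 := by
  rw [logGen, tsum_eq_single 0]
  · simp
  · intro k hk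
    simp [hk]

/-- The generating function `∏ (1 - z^{vw})⁻¹` of `p`, in exponential form. -/
noncomputable def gen (z : ℂ) : ℂ := Complex.exp (logGen z)

theorem analyticAt_gen {z : ℂ} (hz : ‖z‖ < 1) : AnalyticAt ℂ gen z :=
  (analyticAt_logGen hz).cexp

/-- The Taylor coefficients of `gen` are the numbers `p n`. -/
theorem iteratedDeriv_gen (n : ℕ) : iteratedDeriv n gen 0 = (n.factorial : ℂ) * (p n : ℂ) := by
  induction n using Nat.strong_induction_on with
  | _ n ih =>
    rcases n with _ | n
    · simp [gen, logGen_zero, p_zero]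
    -- Leibniz' rule applied to `G' = (log G)' G` at `0` is the recurrence `mul_p_eq_sum`, up to
    -- factorials.
    · have hderiv : deriv gen =ᶠ[𝓝 0] deriv logGen * gen := by
        filter_upwards [Metric.ball_mem_nhds (0 : ℂ) one_pos] with z hz
        rw [mem_ball_zero_iff] at hz
        have := (analyticAt_logGen hz).differentiableAt.hasDerivAt.cexp.deriv
        rw [Pi.mul_apply, mul_comm, gen, ← this]
        rfl
      rw [iteratedDeriv_succ', hderiv.iteratedDeriv_eq,
        iteratedDeriv_mul (analyticAt_logGen (by simp)).deriv.contDiffAt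
          (analyticAt_gen (by simp)).contDiffAt]
      have hrec : ((n + 1 : ℕ) : ℂ) * (p (n + 1) : ℂ) =
          ∑ i ∈ Finset.range (n + 1), (weight (i + 1) : ℂ) * (p (n - i) : ℂ) := by
        have h := mul_p_eq_sum (n + 1)
        have hshift : ∑ k ∈ Finset.Icc 1 (n + 1), weight k * p (n + 1 - k) =
            ∑ i ∈ Finset.range (n + 1), weight (i + 1) * p (n - i) := by
          rw [Finset.range_eq_Ico, ← Finset.Ico_succ_right_eq_Icc]
          simpa using (Finset.sum_Ico_add' (fun k => weight k * p (n + 1 - k)) 0 (n + 1) 1).symm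
        rw [hshift] at h
        exact_mod_cast h
      rw [Nat.factorial_succ, Nat.cast_mul, mul_comm ((n + 1 : ℕ) : ℂ), mul_assoc, hrec,
        Finset.mul_sum]
      refine Finset.sum_congr rfl fun i hi => ?_
      have hin : i ≤ n := Nat.lt_succ_iff.1 (Finset.mem_range.1 hi)
      rw [← iteratedDeriv_succ', iteratedDeriv_logGen, ih (n - i) (by omega),
        ← Nat.choose_mul_factorial_mul_factorial hin, Nat.factorial_succ]
      have : ((i + 1 : ℕ) : ℂ) ≠ 0 := Nat.cast_ne_zero.2 (Nat.succ_ne_zero i)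
      push_cast at this ⊢
      field_simp

/-- Cauchy's integral formula for `p n`. -/
theorem integral_gen_div_pow (n : ℕ) {r : ℝ} (h0 : 0 < r) (h1 : r < 1) :
    ∫ θ in (-Real.pi)..Real.pi, gen (r * Complex.exp (θ * Complex.I)) /
      (r * Complex.exp (θ * Complex.I)) ^ n = 2 * Real.pi * p n := by
  have hd : DifferentiableOn ℂ gen (Metric.closedBall 0 r) := fun z hz =>
    (analyticAt_gen ((mem_closedBall_zero_iff.1 hz).trans_lt h1)).differentiableAt
      |>.differentiableWithinAt
  have h := hd.circleIntegral_one_div_sub_center_pow_smul h0 n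
  rw [iteratedDeriv_gen, circleIntegral] at h
  have hint : ∀ θ : ℝ, deriv (circleMap 0 r) θ • (1 / (circleMap 0 r θ - 0) ^ (n + 1)) •
      gen (circleMap 0 r θ) = Complex.I * (gen (r * Complex.exp (θ * Complex.I)) /
        (r * Complex.exp (θ * Complex.I)) ^ n) := by
    intro θ
    have hne : (r : ℂ) * Complex.exp (θ * Complex.I) ≠ 0 :=
      mul_ne_zero (by exact_mod_cast h0.ne') (Complex.exp_ne_zero _)
    rw [deriv_circleMap]
    simp only [circleMap, zero_add, sub_zero, smul_eq_mul]
    field_simp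
    ring
  simp_rw [hint] at h
  rw [intervalIntegral.integral_const_mul] at h
  have hfac : (n.factorial : ℂ) ≠ 0 := Nat.cast_ne_zero.2 n.factorial_ne_zero
  have h2 : ∫ θ in (0 : ℝ)..2 * Real.pi, gen (r * Complex.exp (θ * Complex.I)) /
      (r * Complex.exp (θ * Complex.I)) ^ n = 2 * Real.pi * p n := by
    apply mul_left_cancel₀ Complex.I_ne_zero
    rw [h, smul_eq_mul]
    field_simp
  rw [← h2]
  have hper : Function.Periodic (fun θ : ℝ => gen (r * Complex.exp (θ * Complex.I)) /
      (r * Complex.exp (θ * Complex.I)) ^ n) (2 * Real.pi) := by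
    intro θ
    have : Complex.exp (((θ + 2 * Real.pi : ℝ) : ℂ) * Complex.I) =
        Complex.exp (θ * Complex.I) := by
      push_cast
      rw [add_mul, Complex.exp_add, Complex.exp_two_pi_mul_I, mul_one]
    simp only [this]
  have h3 := hper.intervalIntegral_add_eq (-Real.pi) 0
  rw [show -Real.pi + 2 * Real.pi = Real.pi by ring, zero_add] at h3
  exact h3

end QuasiIdempotent

/-! ### The phase: Taylor expansion at the saddle point and decay away from it. -/

namespace QuasiIdempotent

open scoped Topology
open Filter

/-- The `S m` are moments of the nonnegative weights `STerm (-1) ω k`, hence, up to constants,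
Taylor coefficients in `θ` of the logarithm on the circle. -/
theorem STerm_natCast (m : ℕ) (ω : ℝ) (k : ℕ) :
    STerm m ω k = (k : ℝ) ^ (m + 1) * STerm (-1) ω k := by
  rw [STerm_eq, STerm_eq, zpow_natCast, zpow_neg_one]
  rcases Nat.eq_zero_or_pos k with rfl | hk
  · simp [weight_zero]
  · have : (k : ℝ) ≠ 0 := by positivity
    field_simp
    ring

theorem hasSum_STerm {m : ℤ} (hm : -1 ≤ m) {ω : ℝ} (hω : 0 < ω) :
    HasSum (STerm m ω) (S m ω) := (summable_STerm hm hω).hasSum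

/-- The exponent `log P(r e^{iθ}) - log P(r) - i S₀ θ` at the radius `r = e^{-1/ω}`. -/
noncomputable def phase (ω θ : ℝ) : ℂ :=
  logGen (Real.exp (-1 / ω) * Complex.exp (θ * Complex.I)) - S (-1) ω - θ * S 0 ω * Complex.I

theorem norm_circle (ω θ : ℝ) :
    ‖(Real.exp (-1 / ω) : ℂ) * Complex.exp (θ * Complex.I)‖ = Real.exp (-1 / ω) := by
  rw [norm_mul, Complex.norm_exp_ofReal_mul_I, mul_one, Complex.norm_real, Real.norm_eq_abs,
    Real.abs_exp]

theorem exp_neg_inv_lt_one {ω : ℝ} (hω : 0 < ω) : Real.exp (-1 / ω) < 1 :=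
  Real.exp_lt_one_iff.2 (div_neg_of_neg_of_pos (by norm_num) hω)

theorem continuous_phase {ω : ℝ} (hω : 0 < ω) : Continuous (phase ω) := by
  have h : Continuous fun θ : ℝ =>
      logGen (Real.exp (-1 / ω) * Complex.exp (θ * Complex.I)) := by
    refine continuous_iff_continuousAt.2 fun θ => ?_
    have h1 := (analyticAt_logGen
      ((norm_circle ω θ).trans_lt (exp_neg_inv_lt_one hω))).continuousAt
    exact ContinuousAt.comp (f := fun θ : ℝ =>
      (Real.exp (-1 / ω) : ℂ) * Complex.exp (θ * Complex.I)) h1 (by fun_prop)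
  unfold phase
  fun_prop

theorem logGen_circle_term (ω θ : ℝ) (k : ℕ) :
    ((weight k : ℂ) / (k : ℂ)) * (Real.exp (-1 / ω) * Complex.exp (θ * Complex.I)) ^ k =
      STerm (-1) ω k * Complex.exp ((k * θ : ℝ) * Complex.I) := by
  rw [STerm_eq, zpow_neg_one, mul_pow, ← Complex.exp_nat_mul, ← Complex.ofReal_pow,
    ← Real.exp_nat_mul]
  have h1 : (k : ℝ) * (-1 / ω) = -(k : ℝ) / ω := by ring
  have h2 : (k : ℂ) * (θ * Complex.I) = (k * θ : ℝ) * Complex.I := by push_cast; ring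
  rw [h1, h2]
  push_cast
  ring

theorem hasSum_logGen_circle {ω : ℝ} (hω : 0 < ω) (θ : ℝ) :
    HasSum (fun k : ℕ => (STerm (-1) ω k : ℂ) * Complex.exp ((k * θ : ℝ) * Complex.I))
      (logGen (Real.exp (-1 / ω) * Complex.exp (θ * Complex.I))) := by
  simp_rw [← logGen_circle_term]
  exact (summable_norm_logGen
    ((norm_circle ω θ).trans_lt (exp_neg_inv_lt_one hω))).of_norm.hasSum

theorem hasSum_phase {ω : ℝ} (hω : 0 < ω) (θ : ℝ) :
    HasSum (fun k : ℕ => (STerm (-1) ω k : ℂ) *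
      (Complex.exp ((k * θ : ℝ) * Complex.I) - 1 - (k * θ : ℝ) * Complex.I)) (phase ω θ) := by
  have h1 := Complex.hasSum_ofReal.2 (hasSum_STerm (m := -1) (by norm_num) hω)
  have h2 := (Complex.hasSum_ofReal.2 (hasSum_STerm (m := 0) (by norm_num) hω)).mul_left
    ((θ : ℂ) * Complex.I)
  have h := ((hasSum_logGen_circle hω θ).sub h1).sub h2
  rw [phase, show (θ : ℂ) * S 0 ω * Complex.I = θ * Complex.I * S 0 ω by ring]
  refine (congrArg (fun f => HasSum f _) (funext fun k => ?_)).mpr h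
  have e0 : STerm 0 ω k = (k : ℝ) ^ 1 * STerm (-1) ω k := STerm_natCast 0 ω k
  rw [e0]
  push_cast
  ring

/-- For `|x| ≤ 1` this is the Taylor remainder; for `|x| ≥ 1` the four terms are bounded separately,
by `7/2 |x|³` in total, whence the constant `4`. -/
theorem norm_exp_mul_I_sub_le (x : ℝ) :
    ‖Complex.exp (x * Complex.I) - 1 - x * Complex.I + (x : ℂ) ^ 2 / 2‖ ≤ 4 * |x| ^ 3 := by
  rcases le_total |x| 1 with hx | hx
  · have hn : ‖(x : ℂ) * Complex.I‖ = |x| := by simp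
    have h := Complex.exp_bound (x := x * Complex.I) (by rw [hn]; exact hx) (n := 3) (by norm_num)
    rw [hn] at h
    have he : Complex.exp (x * Complex.I) - ∑ m ∈ Finset.range 3,
        ((x : ℂ) * Complex.I) ^ m / (m.factorial : ℂ) =
        Complex.exp (x * Complex.I) - 1 - x * Complex.I + (x : ℂ) ^ 2 / 2 := by
      simp [Finset.sum_range_succ, mul_pow]
      ring
    rw [he] at h
    refine h.trans ?_
    rw [mul_comm]
    gcongr
    norm_num [Nat.factorial]
  · have h1 : ‖Complex.exp (x * Complex.I) - 1 - x * Complex.I + (x : ℂ) ^ 2 / 2‖ ≤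
        1 + 1 + |x| + |x| ^ 2 / 2 := by
      refine (norm_add_le _ _).trans (add_le_add ((norm_sub_le _ _).trans
        (add_le_add ((norm_sub_le _ _).trans (add_le_add ?_ ?_)) ?_)) ?_)
      · rw [Complex.norm_exp_ofReal_mul_I]
      · simp
      · simp
      · simp
    have h2 : |x| ≤ |x| ^ 3 := le_self_pow₀ hx (by norm_num)
    have h3 : |x| ^ 2 ≤ |x| ^ 3 := pow_le_pow_right₀ hx (by norm_num)
    linarith

/-- Second order expansion of the exponent at the saddle point. -/
theorem norm_phase_add_le {ω : ℝ} (hω : 0 < ω) (θ : ℝ) :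
    ‖phase ω θ + S 1 ω * (θ : ℂ) ^ 2 / 2‖ ≤ 4 * S 2 ω * |θ| ^ 3 := by
  have h1 := (Complex.hasSum_ofReal.2 (hasSum_STerm (m := 1) (by norm_num) hω)).mul_right
    ((θ : ℂ) ^ 2 / 2)
  have h := (hasSum_phase hω θ).add h1
  have h2 := (hasSum_STerm (m := 2) (by norm_num) hω).mul_left (4 * |θ| ^ 3)
  rw [show (S 1 ω : ℂ) * (θ : ℂ) ^ 2 / 2 = S 1 ω * ((θ : ℂ) ^ 2 / 2) by ring, ← h.tsum_eq,
    show 4 * S 2 ω * |θ| ^ 3 = 4 * |θ| ^ 3 * S 2 ω by ring]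
  refine tsum_of_norm_bounded h2 fun k => ?_
  have e1 : STerm 1 ω k = (k : ℝ) ^ 2 * STerm (-1) ω k := STerm_natCast 1 ω k
  have e2 : STerm 2 ω k = (k : ℝ) ^ 3 * STerm (-1) ω k := STerm_natCast 2 ω k
  rw [e1, e2]
  have h3 := norm_exp_mul_I_sub_le (k * θ)
  rw [abs_mul, Nat.abs_cast, mul_pow] at h3
  have e3 : (STerm (-1) ω k : ℂ) *
      (Complex.exp ((k * θ : ℝ) * Complex.I) - 1 - (k * θ : ℝ) * Complex.I) +
      ((k : ℝ) ^ 2 * STerm (-1) ω k : ℝ) * ((θ : ℂ) ^ 2 / 2) =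
      STerm (-1) ω k * (Complex.exp ((k * θ : ℝ) * Complex.I) - 1 - (k * θ : ℝ) * Complex.I +
        ((k * θ : ℝ) : ℂ) ^ 2 / 2) := by
    push_cast
    ring
  rw [e3, norm_mul, Complex.norm_real, Real.norm_of_nonneg (STerm_nonneg _ _ _)]
  calc _ ≤ STerm (-1) ω k * (4 * ((k : ℝ) ^ 3 * |θ| ^ 3)) :=
        mul_le_mul_of_nonneg_left h3 (STerm_nonneg _ _ _)
    _ = _ := by ring

theorem hasSum_re_phase {ω : ℝ} (hω : 0 < ω) (θ : ℝ) :
    HasSum (fun k : ℕ => STerm (-1) ω k * (Real.cos (k * θ) - 1)) (phase ω θ).re := by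
  refine (congrArg (fun f => HasSum f _) (funext fun k => ?_)).mpr
    (Complex.hasSum_re (hasSum_phase hω θ))
  rw [Complex.re_ofReal_mul, Complex.sub_re, Complex.sub_re, Complex.exp_ofReal_mul_I_re]
  simp

/-- A closed form for `∑ r^k (1 - cos kθ)`. -/
theorem hasSum_geometric_cos {r : ℝ} (h0 : 0 ≤ r) (h1 : r < 1) (θ : ℝ) :
    HasSum (fun k : ℕ => r ^ k * (Real.cos (k * θ) - 1))
      (-(r * (1 + r) * (1 - Real.cos θ) /
        ((1 - r) * ((1 - r) ^ 2 + 2 * r * (1 - Real.cos θ))))) := by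
  -- The sum is `Re (1 - z)⁻¹ - (1 - r)⁻¹`.
  set z : ℂ := r * Complex.exp (θ * Complex.I) with hz
  have hzn : ‖z‖ < 1 := by
    rw [hz, norm_mul, Complex.norm_exp_ofReal_mul_I, mul_one, Complex.norm_real,
      Real.norm_of_nonneg h0]
    exact h1
  have hA := Complex.hasSum_re (hasSum_geometric_of_norm_lt_one hzn)
  have hB := hA.sub (hasSum_geometric_of_lt_one h0 h1)
  have hterm : ∀ k : ℕ, (z ^ k).re - r ^ k = r ^ k * (Real.cos (k * θ) - 1) := by
    intro k
    have : z ^ k = (r ^ k : ℝ) * Complex.exp ((k * θ : ℝ) * Complex.I) := by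
      rw [hz, mul_pow, ← Complex.exp_nat_mul]
      push_cast
      ring_nf
    rw [this, Complex.re_ofReal_mul, Complex.exp_ofReal_mul_I_re]
    ring
  simp_rw [hterm] at hB
  have hre : z.re = r * Real.cos θ := by
    rw [hz, Complex.re_ofReal_mul, Complex.exp_ofReal_mul_I_re]
  have him : z.im = r * Real.sin θ := by
    rw [hz, Complex.im_ofReal_mul, Complex.exp_ofReal_mul_I_im]
  have hns : Complex.normSq (1 - z) = (1 - r) ^ 2 + 2 * r * (1 - Real.cos θ) := by
    rw [Complex.normSq_apply, Complex.sub_re, Complex.sub_im, hre, him, Complex.one_re,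
      Complex.one_im]
    linear_combination r ^ 2 * Real.sin_sq_add_cos_sq θ
  have hd1 : 1 - r ≠ 0 := by linarith
  have hd2 : (1 - r) ^ 2 + 2 * r * (1 - Real.cos θ) ≠ 0 := by
    have := Real.cos_le_one θ
    have h3 : 0 < (1 - r) ^ 2 := by positivity
    have h4 : 0 ≤ 2 * r * (1 - Real.cos θ) := mul_nonneg (by linarith) (by linarith)
    linarith
  have hval : (1 - z)⁻¹.re - (1 - r)⁻¹ = -(r * (1 + r) * (1 - Real.cos θ) /
      ((1 - r) * ((1 - r) ^ 2 + 2 * r * (1 - Real.cos θ)))) := by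
    rw [Complex.inv_re, hns, Complex.sub_re, Complex.one_re, hre, inv_eq_one_div, div_sub_div _ _ hd2 hd1,
      ← neg_div, div_eq_div_iff (mul_ne_zero hd2 hd1) (mul_ne_zero hd1 hd2)]
    ring
  rw [← hval]
  exact hB

/-- Every term of the series for the real part is nonpositive and `weight k / k ≥ 1`, so replacing
these coefficients by `1` can only increase the sum. The term `k = 0` vanishes on both sides. -/
theorem re_phase_le_geometric {ω : ℝ} (hω : 0 < ω) (θ : ℝ) :
    (phase ω θ).re ≤ -(Real.exp (-1 / ω) * (1 + Real.exp (-1 / ω)) * (1 - Real.cos θ) /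
      ((1 - Real.exp (-1 / ω)) *
        ((1 - Real.exp (-1 / ω)) ^ 2 + 2 * Real.exp (-1 / ω) * (1 - Real.cos θ)))) := by
  refine hasSum_le (fun k => ?_) (hasSum_re_phase hω θ)
    (hasSum_geometric_cos (Real.exp_pos _).le (exp_neg_inv_lt_one hω) θ)
  rcases Nat.eq_zero_or_pos k with rfl | hk
  · simp
  · have hcos := Real.cos_le_one (k * θ)
    have hk' : (0 : ℝ) < k := by exact_mod_cast hk
    have hw : (k : ℝ) ≤ weight k := by exact_mod_cast le_weight k
    have h1 : 1 ≤ (weight k : ℝ) * (k : ℝ)⁻¹ := by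
      rw [← div_eq_mul_inv, one_le_div hk']
      exact hw
    have h2 : Real.exp (-1 / ω) ^ k ≤ STerm (-1) ω k := by
      rw [STerm_eq, zpow_neg_one, ← Real.exp_nat_mul,
        show (k : ℝ) * (-1 / ω) = -(k : ℝ) / ω by ring]
      exact le_mul_of_one_le_left (Real.exp_pos _).le h1
    exact mul_le_mul_of_nonpos_right h2 (by linarith)

/-- Decay of the generating function away from the positive axis. -/
theorem re_phase_le {ω θ y : ℝ} (hω : 1 ≤ ω) (hy : 0 ≤ y) (hy1 : y * ω ^ 2 ≤ 1)
    (hyθ : y ≤ 1 - Real.cos θ) : (phase ω θ).re ≤ -(y * ω ^ 3 / 9) := by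
  have hω0 : 0 < ω := by linarith
  refine (re_phase_le_geometric hω0 θ).trans ?_
  rw [neg_le_neg_iff]
  set r := Real.exp (-1 / ω) with hr
  set Y := 1 - Real.cos θ with hY
  have hr1 : r < 1 := exp_neg_inv_lt_one hω0
  have hr2 : 1 / 3 ≤ r := by
    have h1 : Real.exp (-1) ≤ r := Real.exp_le_exp.2 (by
      rw [le_div_iff₀ hω0]; linarith)
    have h2 : Real.exp (-1) = (Real.exp 1)⁻¹ := Real.exp_neg 1
    have h3 : (3 : ℝ)⁻¹ ≤ (Real.exp 1)⁻¹ :=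
      inv_anti₀ (Real.exp_pos 1) (by linarith [Real.exp_one_lt_d9])
    rw [one_div]
    linarith
  have hr3 : ω * (1 - r) ≤ 1 := by
    have h1 := Real.add_one_le_exp (-1 / ω)
    have h2 : 1 - r ≤ 1 / ω := by rw [hr]; linarith [neg_div ω (1 : ℝ)]
    calc ω * (1 - r) ≤ ω * (1 / ω) := by gcongr
      _ = 1 := by field_simp
  have hYnn : 0 ≤ Y := hy.trans hyθ
  have hpos : 0 < 1 - r := by linarith
  have hD : 0 < (1 - r) ^ 2 + 2 * r * Y := by positivity
  rw [div_le_div_iff₀ (by norm_num) (by positivity)]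
  -- Each factor `1 - r` is paired with an `ω`, since `ω (1 - r) ≤ 1`. The constant `9` suffices
  -- because `1 + 2r ≤ 9 r (1 + r)` once `r ≥ 1/3`.
  have e1 : y * ω ^ 3 * ((1 - r) * ((1 - r) ^ 2 + 2 * r * Y)) =
      (ω * (1 - r)) * (y * (ω * (1 - r)) ^ 2 + 2 * r * Y * (y * ω ^ 2)) := by ring
  have hnn : 0 ≤ ω * (1 - r) := by positivity
  have e2 : y * (ω * (1 - r)) ^ 2 ≤ Y := by
    calc y * (ω * (1 - r)) ^ 2 ≤ y * 1 := by gcongr; exact pow_le_one₀ hnn hr3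
      _ ≤ Y := by linarith
  have e3 : 2 * r * Y * (y * ω ^ 2) ≤ 2 * r * Y :=
    mul_le_of_le_one_right (by positivity) hy1
  have e4 : 0 ≤ y * (ω * (1 - r)) ^ 2 + 2 * r * Y * (y * ω ^ 2) := by positivity
  rw [e1]
  calc _ ≤ 1 * (Y + 2 * r * Y) := by gcongr
    _ ≤ r * (1 + r) * Y * 9 := by
      have : 1 + 2 * r ≤ r * (1 + r) * 9 := by nlinarith
      nlinarith

end QuasiIdempotent

/-! ### The Gaussian limit of the saddle point integral. -/

namespace QuasiIdempotent

open scoped Topology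
open Filter

theorem tendsto_const_add_rpow_mul_exp {κ a : ℝ} (hκ : 0 < κ) (ha : 0 < a) (K b : ℝ) :
    Tendsto (fun ω : ℝ => (1 + K * ω ^ b) * Real.exp (-κ * ω ^ a)) atTop (𝓝 0) := by
  have hpow : Tendsto (fun ω : ℝ => ω ^ a) atTop atTop := tendsto_rpow_atTop ha
  have h1 := (tendsto_rpow_mul_exp_neg_mul_atTop_nhds_zero 0 κ hκ).comp hpow
  have h2 := ((tendsto_rpow_mul_exp_neg_mul_atTop_nhds_zero (b / a) κ hκ).comp hpow).const_mul K
  have h := h1.add h2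
  rw [mul_zero, add_zero] at h
  refine h.congr' ?_
  filter_upwards [eventually_gt_atTop 0] with ω hω
  simp only [Function.comp_apply, Real.rpow_zero]
  rw [← Real.rpow_mul hω.le, mul_div_cancel₀ _ ha.ne']
  ring

theorem exp_mul_rpow_le_sqrt_S_one {ω : ℝ} (hω : 1 ≤ ω) :
    Real.exp (-2) * ω ^ (3 / 2 : ℝ) ≤ √(S 1 ω) := by
  have hω0 : 0 < ω := by linarith
  apply Real.le_sqrt_of_sq_le
  have h : Real.exp (-4) * ω ^ 3 ≤ S 1 ω := le_S 1 hω
  refine le_trans (le_of_eq ?_) h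
  rw [mul_pow, ← Real.exp_nat_mul, ← Real.rpow_natCast (ω ^ (3 / 2 : ℝ)) 2, ← Real.rpow_mul hω0.le,
    ← Real.rpow_natCast ω 3]
  norm_num

theorem S_pos (m : ℕ) {ω : ℝ} (hω : 1 ≤ ω) : 0 < S m ω :=
  lt_of_lt_of_le (by positivity) (le_S m hω)

/-- At `θ = u / √S₁` the cubic error is `4 |u|³` times this ratio. The bounds give the exponent
`17/4 - 9/2 = -1/4`. -/
theorem tendsto_S_two_div : Tendsto (fun ω : ℝ => S 2 ω / √(S 1 ω) ^ 3) atTop (𝓝 0) := by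
  obtain ⟨C, hC, hle⟩ := exists_S_le (m := 2) (by norm_num)
  have hlim : Tendsto (fun ω : ℝ => C * Real.exp 6 * ω ^ (-(1 / 4) : ℝ)) atTop (𝓝 0) := by
    simpa using (tendsto_rpow_neg_atTop (y := 1 / 4) (by norm_num)).const_mul (C * Real.exp 6)
  refine squeeze_zero' ?_ ?_ hlim
  · filter_upwards [eventually_ge_atTop 1] with ω hω
    have : 0 < S 2 ω := S_pos 2 hω
    positivity
  · filter_upwards [eventually_ge_atTop 1] with ω hω
    have hω0 : 0 < ω := by linarith
    have h1 := exp_mul_rpow_le_sqrt_S_one hω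
    have h2 := hle ω hω0
    have h3 : Real.exp (-6) * ω ^ (9 / 2 : ℝ) ≤ √(S 1 ω) ^ 3 := by
      calc Real.exp (-6) * ω ^ (9 / 2 : ℝ) = (Real.exp (-2) * ω ^ (3 / 2 : ℝ)) ^ 3 := by
            rw [mul_pow, ← Real.exp_nat_mul, ← Real.rpow_natCast (ω ^ (3 / 2 : ℝ)) 3,
              ← Real.rpow_mul hω0.le]
            norm_num
        _ ≤ _ := by gcongr
    have h4 : 0 < Real.exp (-6) * ω ^ (9 / 2 : ℝ) := by positivity
    rw [div_le_iff₀ (h4.trans_le h3)]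
    calc S 2 ω ≤ C * ω ^ (((2 : ℤ) : ℝ) + 9 / 4) := h2
      _ = C * Real.exp 6 * ω ^ (-(1 / 4) : ℝ) * (Real.exp (-6) * ω ^ (9 / 2 : ℝ)) := by
          have e1 : Real.exp 6 * Real.exp (-6) = 1 := by rw [← Real.exp_add]; simp
          have e2 : ω ^ (-(1 / 4) : ℝ) * ω ^ (9 / 2 : ℝ) = ω ^ (((2 : ℤ) : ℝ) + 9 / 4) := by
            rw [← Real.rpow_add hω0]; norm_num
          rw [← e2]
          linear_combination -(C * ω ^ (-(1 / 4) : ℝ) * ω ^ (9 / 2 : ℝ)) * e1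
      _ ≤ _ := by gcongr

/-- The exponent near the saddle point is at most half of its quadratic part. -/
theorem re_phase_le_of_small {ω θ : ℝ} (hω : 1 ≤ ω) (hθ : 16 * S 2 ω * |θ| ≤ S 1 ω) :
    (phase ω θ).re ≤ -(S 1 ω * θ ^ 2 / 4) := by
  have h := (Complex.re_le_norm _).trans (norm_phase_add_le (zero_lt_one.trans_le hω) θ)
  have e : (S 1 ω * (θ : ℂ) ^ 2 / 2) = ((S 1 ω * θ ^ 2 / 2 : ℝ) : ℂ) := by push_cast; ring
  rw [e, Complex.add_re, Complex.ofReal_re] at h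
  -- The threshold `16` makes the cubic error at most half of the quadratic term `S₁ θ²/2`.
  have h1 : 4 * S 2 ω * |θ| ^ 3 ≤ S 1 ω * θ ^ 2 / 4 := by
    calc 4 * S 2 ω * |θ| ^ 3 = 16 * S 2 ω * |θ| * |θ| ^ 2 / 4 := by ring
      _ ≤ S 1 ω * |θ| ^ 2 / 4 := by gcongr
      _ = _ := by rw [sq_abs]
  linarith

/-- Away from the saddle point the generating function is smaller by a factor
`exp (-κ √ω)`. -/
theorem exists_re_phase_le_of_large :
    ∃ κ : ℝ, 0 < κ ∧ ∀ ω θ : ℝ, 1 ≤ ω → |θ| ≤ Real.pi → S 1 ω ≤ 16 * S 2 ω * |θ| →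
      (phase ω θ).re ≤ -κ * ω ^ (1 / 2 : ℝ) := by
  obtain ⟨C, hC, hle⟩ := exists_S_le (m := 2) (by norm_num)
  -- The first entry makes the hypothesis force `|θ| ≥ c ω^(-5/4)`, where `-5/4 = 3 - 17/4`; the
  -- bound by `1` secures `y ω² ≤ 1` in `re_phase_le`.
  set c : ℝ := min (Real.exp (-4) / (16 * C)) 1 with hc
  have hc0 : 0 < c := lt_min (by positivity) one_pos
  have hc1 : c ≤ 1 := min_le_right _ _
  have hcC : c * (16 * C) ≤ Real.exp (-4) := by
    rw [← le_div_iff₀ (by positivity)]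
    exact min_le_left _ _
  -- `45 = 5 · 9`: the `5` comes from `2/π² ≥ 1/5` in the cosine bound, the `9` from `re_phase_le`.
  refine ⟨c ^ 2 / 45, by positivity, fun ω θ hω hθ hS => ?_⟩
  have hω0 : 0 < ω := by linarith
  have hlow : c * ω ^ (-(5 / 4) : ℝ) ≤ |θ| := by
    have h1 : Real.exp (-4) * ω ^ 3 ≤ S 1 ω := le_S 1 hω
    have h2 := hle ω hω0
    have h3 : c * (16 * C) * ω ^ 3 ≤ 16 * (C * ω ^ (((2 : ℤ) : ℝ) + 9 / 4)) * |θ| := by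
      calc c * (16 * C) * ω ^ 3 ≤ Real.exp (-4) * ω ^ 3 := by gcongr
        _ ≤ 16 * S 2 ω * |θ| := h1.trans hS
        _ ≤ _ := by gcongr
    have e : ω ^ 3 = ω ^ (-(5 / 4) : ℝ) * ω ^ (((2 : ℤ) : ℝ) + 9 / 4) := by
      rw [← Real.rpow_add hω0, ← Real.rpow_natCast]
      norm_num
    rw [e] at h3
    have hpos : 0 < 16 * C * ω ^ (((2 : ℤ) : ℝ) + 9 / 4) := by positivity
    refine le_of_mul_le_mul_right ?_ hpos
    linarith
  have esq : (ω ^ (-(5 / 4) : ℝ)) ^ 2 = ω ^ (-(5 / 2) : ℝ) := by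
    rw [← Real.rpow_natCast, ← Real.rpow_mul hω0.le]; norm_num
  have hy : c ^ 2 / 5 * ω ^ (-(5 / 2) : ℝ) ≤ 1 - Real.cos θ := by
    have h1 := Real.cos_le_one_sub_mul_cos_sq hθ
    have h2 : (1 : ℝ) / 5 ≤ 2 / Real.pi ^ 2 := by
      rw [div_le_div_iff₀ (by norm_num) (by positivity)]
      nlinarith [Real.pi_lt_d2, Real.pi_pos]
    have h3 : (c * ω ^ (-(5 / 4) : ℝ)) ^ 2 ≤ θ ^ 2 := by
      rw [← sq_abs θ]
      gcongr
    rw [mul_pow, esq] at h3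
    nlinarith [mul_le_mul_of_nonneg_right h2 (sq_nonneg θ)]
  have hy1 : c ^ 2 / 5 * ω ^ (-(5 / 2) : ℝ) * ω ^ 2 ≤ 1 := by
    have e : ω ^ (-(5 / 2) : ℝ) * ω ^ 2 = ω ^ (-(1 / 2) : ℝ) := by
      rw [← Real.rpow_natCast ω 2, ← Real.rpow_add hω0]; norm_num
    rw [mul_assoc, e]
    have h1 : ω ^ (-(1 / 2) : ℝ) ≤ 1 := Real.rpow_le_one_of_one_le_of_nonpos hω (by norm_num)
    have h2 : c ^ 2 ≤ 1 := pow_le_one₀ hc0.le hc1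
    exact mul_le_one₀ (by linarith) (by positivity) h1
  refine (re_phase_le hω (by positivity) hy1 hy).trans (le_of_eq ?_)
  have e : ω ^ (-(5 / 2) : ℝ) * ω ^ 3 = ω ^ (1 / 2 : ℝ) := by
    rw [← Real.rpow_natCast ω 3, ← Real.rpow_add hω0]; norm_num
  rw [← e]
  ring

theorem tendsto_phase_rescaled (u : ℝ) :
    Tendsto (fun ω : ℝ => phase ω (u / √(S 1 ω))) atTop (𝓝 (-(u : ℂ) ^ 2 / 2)) := by
  rw [tendsto_iff_norm_sub_tendsto_zero]
  have hlim : Tendsto (fun ω : ℝ => 4 * |u| ^ 3 * (S 2 ω / √(S 1 ω) ^ 3)) atTop (𝓝 0) := by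
    simpa using tendsto_S_two_div.const_mul (4 * |u| ^ 3)
  refine squeeze_zero' (Eventually.of_forall fun _ => norm_nonneg _) ?_ hlim
  filter_upwards [eventually_ge_atTop 1] with ω hω
  have hS : 0 < S 1 ω := S_pos 1 hω
  have h := norm_phase_add_le (zero_lt_one.trans_le hω) (u / √(S 1 ω))
  have e : (S 1 ω : ℂ) * ((u / √(S 1 ω) : ℝ) : ℂ) ^ 2 / 2 = (u : ℂ) ^ 2 / 2 := by
    have h1 : S 1 ω * (u / √(S 1 ω)) ^ 2 / 2 = u ^ 2 / 2 := by
      rw [div_pow, Real.sq_sqrt hS.le]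
      field_simp
    exact_mod_cast congrArg (Complex.ofReal) h1
  rw [e, abs_div, abs_of_nonneg (Real.sqrt_nonneg _), div_pow] at h
  rw [neg_div, sub_neg_eq_add]
  refine h.trans (le_of_eq ?_)
  ring

/-- The rescaled integrand is eventually dominated by an integrable function. -/
theorem eventually_norm_exp_phase_le :
    ∀ᶠ ω : ℝ in atTop, ∀ u : ℝ, |u| ≤ Real.pi * √(S 1 ω) →
      ‖Complex.exp (phase ω (u / √(S 1 ω)))‖ ≤
        Real.exp (-(1 / 4) * u ^ 2) + (1 + u ^ 2)⁻¹ := by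
  obtain ⟨κ, hκ, hlarge⟩ := exists_re_phase_le_of_large
  obtain ⟨C, hC, hle⟩ := exists_S_le (m := 1) (by norm_num)
  have hlim := tendsto_const_add_rpow_mul_exp hκ (a := 1 / 2) (by norm_num)
    (Real.pi ^ 2 * C) (((1 : ℤ) : ℝ) + 9 / 4)
  filter_upwards [eventually_ge_atTop 1, hlim.eventually_le_const one_pos] with ω hω hsmall u hu
  have hω0 : 0 < ω := by linarith
  have hS : 0 < S 1 ω := S_pos 1 hω
  have hsq : 0 < √(S 1 ω) := Real.sqrt_pos.2 hS
  rw [Complex.norm_exp]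
  set θ := u / √(S 1 ω) with hθ
  have hu2 : S 1 ω * θ ^ 2 = u ^ 2 := by
    rw [hθ, div_pow, Real.sq_sqrt hS.le]
    field_simp
  rcases le_total (16 * S 2 ω * |θ|) (S 1 ω) with h | h
  · have h1 := re_phase_le_of_small hω h
    have h2 : Real.exp (phase ω θ).re ≤ Real.exp (-(1 / 4) * u ^ 2) :=
      Real.exp_le_exp.2 (by linarith)
    have h3 : 0 < (1 + u ^ 2)⁻¹ := by positivity
    linarith
  · have hθπ : |θ| ≤ Real.pi := by
      rw [hθ, abs_div, abs_of_pos hsq, div_le_iff₀ hsq]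
      exact hu
    have h1 := hlarge ω θ hω hθπ h
    have h2 : Real.exp (phase ω θ).re ≤ Real.exp (-κ * ω ^ (1 / 2 : ℝ)) := Real.exp_le_exp.2 h1
    -- On the far arc `u²` is at most polynomial in `ω`, so `exp (-κ √ω)` lies below the integrable
    -- `(1 + u²)⁻¹`.
    have h3 : 1 + u ^ 2 ≤ 1 + Real.pi ^ 2 * C * ω ^ (((1 : ℤ) : ℝ) + 9 / 4) := by
      have h4 : |u| ^ 2 ≤ (Real.pi * √(S 1 ω)) ^ 2 := by gcongr
      rw [sq_abs, mul_pow, Real.sq_sqrt hS.le] at h4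
      have h5 : Real.pi ^ 2 * S 1 ω ≤ Real.pi ^ 2 * (C * ω ^ (((1 : ℤ) : ℝ) + 9 / 4)) := by
        gcongr
        exact hle ω hω0
      linarith
    have h6 : Real.exp (-κ * ω ^ (1 / 2 : ℝ)) ≤ (1 + u ^ 2)⁻¹ := by
      rw [← one_div, le_div_iff₀ (by positivity), mul_comm]
      exact (mul_le_mul_of_nonneg_right h3 (Real.exp_pos _).le).trans hsmall
    have h7 := Real.exp_pos (-(1 / 4) * u ^ 2)
    linarith

/-- The saddle point integral is asymptotically Gaussian. -/
theorem tendsto_sqrt_mul_integral_exp_phase :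
    Tendsto (fun ω : ℝ => (√(S 1 ω) : ℂ) *
      ∫ θ in (-Real.pi)..Real.pi, Complex.exp (phase ω θ)) atTop (𝓝 (√(2 * Real.pi) : ℂ)) := by
  -- The rescaled integrand is extended by zero so that all integrals run over the same line.
  set G : ℝ → ℝ → ℂ := fun ω => (Set.Ioc (-(Real.pi * √(S 1 ω))) (Real.pi * √(S 1 ω))).indicator
    fun u => Complex.exp (phase ω (u / √(S 1 ω))) with hG
  have hgauss : ∫ u : ℝ, Complex.exp (-(u : ℂ) ^ 2 / 2) = (√(2 * Real.pi) : ℂ) := by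
    have h := integral_gaussian (1 / 2)
    rw [show Real.pi / (1 / 2) = 2 * Real.pi by ring] at h
    rw [← h, ← integral_complex_ofReal]
    congr 1
    funext u
    push_cast
    congr 1
    ring
  have hDCT : Tendsto (fun ω => ∫ u, G ω u) atTop (𝓝 (∫ u : ℝ, Complex.exp (-(u : ℂ) ^ 2 / 2))) := by
    refine MeasureTheory.tendsto_integral_filter_of_dominated_convergence
      (fun u : ℝ => Real.exp (-(1 / 4) * u ^ 2) + (1 + u ^ 2)⁻¹) ?_ ?_ ?_ ?_
    · filter_upwards [eventually_gt_atTop 0] with ω hω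
      refine Continuous.aestronglyMeasurable ?_ |>.indicator measurableSet_Ioc
      exact Complex.continuous_exp.comp ((continuous_phase hω).comp (continuous_id.div_const _))
    · filter_upwards [eventually_norm_exp_phase_le] with ω hω
      refine Eventually.of_forall fun u => ?_
      by_cases hu : u ∈ Set.Ioc (-(Real.pi * √(S 1 ω))) (Real.pi * √(S 1 ω))
      · rw [hG]
        simp only [Set.indicator_of_mem hu]
        exact hω u (abs_le.2 ⟨hu.1.le, hu.2⟩)
      · rw [hG]
        simp only [Set.indicator_of_notMem hu, norm_zero]
        positivity
    · exact (integrable_exp_neg_mul_sq (by norm_num)).add integrable_inv_one_add_sq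
    · refine Eventually.of_forall fun u => ?_
      have h1 : Tendsto (fun ω : ℝ => Complex.exp (phase ω (u / √(S 1 ω)))) atTop
          (𝓝 (Complex.exp (-(u : ℂ) ^ 2 / 2))) :=
        (Complex.continuous_exp.tendsto _).comp (tendsto_phase_rescaled u)
      refine h1.congr' ?_
      have hbig : Tendsto (fun ω : ℝ => Real.exp (-2) * ω ^ (3 / 2 : ℝ)) atTop atTop :=
        (tendsto_rpow_atTop (by norm_num)).const_mul_atTop (Real.exp_pos _)
      filter_upwards [eventually_ge_atTop 1, hbig.eventually_gt_atTop |u|] with ω hω hu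
      have h2 : |u| < Real.pi * √(S 1 ω) := by
        have h3 := exp_mul_rpow_le_sqrt_S_one hω
        have h4 := Real.sqrt_nonneg (S 1 ω)
        nlinarith [Real.pi_gt_three]
      rw [hG]
      simp only
      rw [Set.indicator_of_mem]
      exact ⟨(abs_lt.1 h2).1, (abs_lt.1 h2).2.le⟩
  rw [hgauss] at hDCT
  refine hDCT.congr' ?_
  filter_upwards [eventually_ge_atTop 1] with ω hω
  have hS : 0 < S 1 ω := S_pos 1 hω
  have hsq : 0 < √(S 1 ω) := Real.sqrt_pos.2 hS
  have h1 := intervalIntegral.integral_comp_div (a := -(Real.pi * √(S 1 ω)))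
    (b := Real.pi * √(S 1 ω)) (fun θ => Complex.exp (phase ω θ)) hsq.ne'
  rw [neg_div, mul_div_cancel_right₀ _ hsq.ne'] at h1
  rw [← Complex.real_smul, ← h1, hG]
  simp only
  rw [MeasureTheory.integral_indicator measurableSet_Ioc, intervalIntegral.integral_of_le]
  have : 0 ≤ Real.pi * √(S 1 ω) := by positivity
  linarith

end QuasiIdempotent

/-! ### Asymptotics of `p`, and transfer to `q`. -/

namespace QuasiIdempotent

open scoped Topology
open Filter

/-- The factor `exp (-i n θ)` from the power is exactly the linear term of `phase`, because `S₀ ω =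
n`; the modulus of the power gives `exp (n/ω)`. -/
theorem gen_div_pow_eq {n : ℕ} {ω : ℝ} (hω : 0 < ω) (hS : S 0 ω = n) (θ : ℝ) :
    gen (Real.exp (-1 / ω) * Complex.exp (θ * Complex.I)) /
      (Real.exp (-1 / ω) * Complex.exp (θ * Complex.I)) ^ n =
    (Real.exp (S (-1) ω + n / ω) : ℂ) * Complex.exp (phase ω θ) := by
  rw [div_eq_iff (pow_ne_zero _ (mul_ne_zero (by simp) (Complex.exp_ne_zero _))), gen, phase, hS]
  generalize logGen (Real.exp (-1 / ω) * Complex.exp (θ * Complex.I)) = L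
  rw [mul_pow, ← Complex.exp_nat_mul, Complex.ofReal_exp, Complex.ofReal_exp, ← Complex.exp_nat_mul,
    ← Complex.exp_add, ← Complex.exp_add, ← Complex.exp_add]
  congr 1
  have : (ω : ℂ) ≠ 0 := by exact_mod_cast hω.ne'
  push_cast
  field_simp
  ring

theorem integral_exp_phase_eq {n : ℕ} {ω : ℝ} (hω : 0 < ω) (hS : S 0 ω = n) :
    (Real.exp (S (-1) ω + n / ω) : ℂ) *
      ∫ θ in (-Real.pi)..Real.pi, Complex.exp (phase ω θ) = 2 * Real.pi * p n := by
  rw [← integral_gen_div_pow n (Real.exp_pos (-1 / ω)) (exp_neg_inv_lt_one hω),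
    ← intervalIntegral.integral_const_mul]
  simp_rw [gen_div_pow_eq hω hS]

theorem norm_gen_le {ω : ℝ} (hω : 0 < ω) (θ : ℝ) :
    ‖gen (Real.exp (-1 / ω) * Complex.exp (θ * Complex.I))‖ ≤ Real.exp (S (-1) ω) := by
  rw [gen, Complex.norm_exp]
  refine Real.exp_le_exp.2 ((Complex.re_le_norm _).trans ?_)
  exact tsum_of_norm_bounded (hasSum_STerm (by norm_num) hω)
    fun k => (norm_logGen_term ω (norm_circle ω θ) k).le

/-- The trivial bound `p_m ≤ P(r) r^{-m}`. -/
theorem p_le_exp (m : ℕ) {ω : ℝ} (hω : 0 < ω) :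
    (p m : ℝ) ≤ Real.exp (S (-1) ω + m / ω) := by
  have h := integral_gen_div_pow m (Real.exp_pos (-1 / ω)) (exp_neg_inv_lt_one hω)
  have hb : ∀ θ ∈ Set.uIoc (-Real.pi) Real.pi,
      ‖gen (Real.exp (-1 / ω) * Complex.exp (θ * Complex.I)) /
        (Real.exp (-1 / ω) * Complex.exp (θ * Complex.I)) ^ m‖ ≤
      Real.exp (S (-1) ω + m / ω) := by
    intro θ _
    rw [norm_div, norm_pow, norm_circle, ← Real.exp_nat_mul, div_le_iff₀ (Real.exp_pos _),
      ← Real.exp_add, show S (-1) ω + m / ω + m * (-1 / ω) = S (-1) ω by ring]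
    exact norm_gen_le hω θ
  have h2 := intervalIntegral.norm_integral_le_of_norm_le_const hb
  rw [h] at h2
  have h3 : ‖(2 * Real.pi * p m : ℂ)‖ = 2 * Real.pi * p m := by
    rw [norm_mul, norm_mul, Complex.norm_natCast, Complex.norm_real,
      Real.norm_of_nonneg Real.pi_pos.le]
    simp
  rw [h3, show |Real.pi - -Real.pi| = 2 * Real.pi by
    rw [sub_neg_eq_add, ← two_mul, abs_of_pos Real.two_pi_pos], mul_comm] at h2
  exact le_of_mul_le_mul_right h2 Real.two_pi_pos

/-- The saddle point approximation to `p n`. -/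
noncomputable def saddle (n : ℕ) (ω : ℝ) : ℝ :=
  1 / √(2 * Real.pi * S 1 ω) * Real.exp (S (-1) ω + (n : ℝ) / ω)

theorem tendsto_p_div_saddle {ω : ℕ → ℝ}
    (hω : ∀ n : ℕ, 1 ≤ n → 0 < ω n ∧ S 0 (ω n) = (n : ℝ)) :
    Tendsto (fun n : ℕ => (p n : ℝ) / saddle n (ω n)) atTop (𝓝 1) := by
  have h1 := (tendsto_sqrt_mul_integral_exp_phase.comp (tendsto_saddle hω)).const_mul
    ((√(2 * Real.pi) : ℂ) / (2 * Real.pi))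
  have h2 := (Complex.continuous_re.tendsto _).comp h1
  have hpi : (0 : ℝ) < 2 * Real.pi := Real.two_pi_pos
  have hlim : ((√(2 * Real.pi) : ℂ) / (2 * Real.pi) * (√(2 * Real.pi) : ℂ)).re = 1 := by
    have : (√(2 * Real.pi) : ℂ) / (2 * Real.pi) * (√(2 * Real.pi) : ℂ) =
        ((√(2 * Real.pi) * √(2 * Real.pi) / (2 * Real.pi) : ℝ) : ℂ) := by
      push_cast
      ring
    rw [this, Complex.ofReal_re, Real.mul_self_sqrt hpi.le, div_self hpi.ne']
  rw [hlim] at h2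
  refine h2.congr' ?_
  filter_upwards [eventually_ge_atTop 1] with n hn
  obtain ⟨h0, hS⟩ := hω n hn
  have hint := integral_exp_phase_eq h0 hS
  set E := Real.exp (S (-1) (ω n) + n / ω n) with hE
  have hE0 : 0 < E := Real.exp_pos _
  have hE' : (E : ℂ) ≠ 0 := by exact_mod_cast hE0.ne'
  have hint' : ∫ θ in (-Real.pi)..Real.pi, Complex.exp (phase (ω n) θ) =
      ((2 * Real.pi * p n / E : ℝ) : ℂ) := by
    push_cast
    rw [eq_div_iff hE', mul_comm]
    exact hint
  simp only [Function.comp_apply]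
  rw [hint']
  have hreal : (√(2 * Real.pi) : ℂ) / (2 * Real.pi) *
      ((√(S 1 (ω n)) : ℂ) * ((2 * Real.pi * p n / E : ℝ) : ℂ)) =
      ((√(2 * Real.pi) / (2 * Real.pi) * (√(S 1 (ω n)) * (2 * Real.pi * p n / E)) : ℝ) : ℂ) := by
    push_cast
    ring
  rw [hreal, Complex.ofReal_re, saddle, ← hE, Real.sqrt_mul hpi.le]
  rw [one_div, div_mul_eq_div_div (p n : ℝ), div_inv_eq_mul]
  field_simp

/-- Superpolynomial decay of `P(r) r^{-n/2}` relative to the saddle point approximation. -/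
theorem tendsto_half_saddle :
    Tendsto (fun ω : ℝ => S 0 ω * √(2 * Real.pi * S 1 ω) * Real.exp (-(S 0 ω / (2 * ω))))
      atTop (𝓝 0) := by
  obtain ⟨C₀, hC₀, h₀⟩ := exists_S_le (m := 0) (by norm_num)
  obtain ⟨C₁, hC₁, h₁⟩ := exists_S_le (m := 1) (by norm_num)
  -- Half of the rate `exp (-4) / 2` from `S₀/(2ω) ≥ exp (-4) ω / 2`: one copy of `exp (-κ ω)` for
  -- each of the two polynomial factors.
  set κ : ℝ := Real.exp (-4) / 4 with hκ
  have hκ0 : 0 < κ := by positivity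
  have hl0 := tendsto_const_add_rpow_mul_exp hκ0 one_pos C₀ (((0 : ℤ) : ℝ) + 9 / 4)
  have hl1 := tendsto_const_add_rpow_mul_exp hκ0 one_pos (2 * Real.pi * C₁) (((1 : ℤ) : ℝ) + 9 / 4)
  have hl := hl0.mul hl1
  rw [mul_zero] at hl
  refine squeeze_zero' ?_ ?_ hl
  · filter_upwards [eventually_ge_atTop 1] with ω hω
    have : 0 < S 0 ω := S_pos 0 hω
    positivity
  · filter_upwards [eventually_ge_atTop 1] with ω hω
    have hω0 : 0 < ω := by linarith
    have hS0 : 0 < S 0 ω := S_pos 0 hω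
    have hS1 : 0 < S 1 ω := S_pos 1 hω
    have hb0 : S 0 ω ≤ 1 + C₀ * ω ^ (((0 : ℤ) : ℝ) + 9 / 4) := by linarith [h₀ ω hω0]
    have hb1 : √(2 * Real.pi * S 1 ω) ≤ 1 + 2 * Real.pi * C₁ * ω ^ (((1 : ℤ) : ℝ) + 9 / 4) := by
      have h2 : 2 * Real.pi * S 1 ω ≤ 2 * Real.pi * (C₁ * ω ^ (((1 : ℤ) : ℝ) + 9 / 4)) := by
        gcongr
        exact h₁ ω hω0
      have h3 : 0 ≤ 2 * Real.pi * S 1 ω := by positivity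
      rw [Real.sqrt_le_iff]
      constructor
      · linarith
      · nlinarith
    have hexp : Real.exp (-(S 0 ω / (2 * ω))) ≤
        Real.exp (-κ * ω ^ (1 : ℝ)) * Real.exp (-κ * ω ^ (1 : ℝ)) := by
      rw [← Real.exp_add, Real.rpow_one]
      apply Real.exp_le_exp.2
      have h2 : Real.exp (-4) * ω ^ 2 ≤ S 0 ω := le_S 0 hω
      have h3 : Real.exp (-4) * ω / 2 ≤ S 0 ω / (2 * ω) := by
        rw [le_div_iff₀ (by positivity)]
        linarith
      rw [hκ]
      linarith
    calc _ ≤ (1 + C₀ * ω ^ (((0 : ℤ) : ℝ) + 9 / 4)) *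
          (1 + 2 * Real.pi * C₁ * ω ^ (((1 : ℤ) : ℝ) + 9 / 4)) *
          (Real.exp (-κ * ω ^ (1 : ℝ)) * Real.exp (-κ * ω ^ (1 : ℝ))) := by gcongr
      _ = _ := by ring

/-- At most `n` divisors occur, and each `n / d` is at most `n/2`; the trivial bound is taken at the
same `ω` for all of them, so that `S₋₁ ω` cancels against the main term. -/
theorem p_sub_q_le {n : ℕ} (hn : 1 ≤ n) {ω : ℝ} (hω : 0 < ω) :
    (p n : ℝ) - q n ≤ n * Real.exp (S (-1) ω + n / (2 * ω)) := by
  have h : (p n : ℝ) ≤ q n + ∑ d ∈ Finset.Icc 2 n, (p (n / d) : ℝ) := by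
    exact_mod_cast p_le_q_add_sum hn
  have hsum : ∑ d ∈ Finset.Icc 2 n, (p (n / d) : ℝ) ≤
      ∑ _d ∈ Finset.Icc 2 n, Real.exp (S (-1) ω + n / (2 * ω)) := by
    refine Finset.sum_le_sum fun d hd => (p_le_exp (n / d) hω).trans (Real.exp_le_exp.2 ?_)
    have h2 : ((n / d : ℕ) : ℝ) ≤ n / 2 := by
      refine Nat.cast_div_le.trans ?_
      have : (2 : ℝ) ≤ d := by exact_mod_cast (Finset.mem_Icc.1 hd).1
      gcongr
    have h3 : ((n / d : ℕ) : ℝ) / ω ≤ n / (2 * ω) := by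
      rw [← div_div]
      gcongr
    linarith
  rw [Finset.sum_const, nsmul_eq_mul] at hsum
  have hcard : ((Finset.Icc 2 n).card : ℝ) ≤ n := by
    rw [Nat.card_Icc]
    exact_mod_cast (by omega : n + 1 - 2 ≤ n)
  have := mul_le_mul_of_nonneg_right hcard (Real.exp_pos (S (-1) ω + n / (2 * ω))).le
  linarith

theorem saddle_pos (n : ℕ) {ω : ℝ} (hω : 1 ≤ ω) : 0 < saddle n ω := by
  have : 0 < S 1 ω := S_pos 1 hω
  unfold saddle
  positivity

theorem tendsto_p_sub_q_div_saddle {ω : ℕ → ℝ}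
    (hω : ∀ n : ℕ, 1 ≤ n → 0 < ω n ∧ S 0 (ω n) = (n : ℝ)) :
    Tendsto (fun n : ℕ => ((p n : ℝ) - q n) / saddle n (ω n)) atTop (𝓝 0) := by
  have hlim := tendsto_half_saddle.comp (tendsto_saddle hω)
  refine squeeze_zero' ?_ ?_ hlim
  · filter_upwards [(tendsto_saddle hω).eventually_ge_atTop 1] with n h1
    have : (q n : ℝ) ≤ p n := by exact_mod_cast q_le_p n
    exact div_nonneg (by linarith) (saddle_pos n h1).le
  · filter_upwards [eventually_ge_atTop 1, (tendsto_saddle hω).eventually_ge_atTop 1] with n hn h1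
    obtain ⟨h0, hS⟩ := hω n hn
    have hS1 : 0 < S 1 (ω n) := S_pos 1 h1
    simp only [Function.comp_apply]
    rw [div_le_iff₀ (saddle_pos n h1), hS, saddle]
    refine (p_sub_q_le hn h0).trans (le_of_eq ?_)
    have hs : √(2 * Real.pi * S 1 (ω n)) ≠ 0 := by positivity
    have he : Real.exp (S (-1) (ω n) + n / (2 * ω n)) =
        Real.exp (-(n / (2 * ω n))) * Real.exp (S (-1) (ω n) + n / ω n) := by
      rw [← Real.exp_add]
      congr 1
      field_simp
      ring
    rw [he]
    field_simp

theorem tendsto_q_div_saddle {ω : ℕ → ℝ}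
    (hω : ∀ n : ℕ, 1 ≤ n → 0 < ω n ∧ S 0 (ω n) = (n : ℝ)) :
    Tendsto (fun n : ℕ => (q n : ℝ) / saddle n (ω n)) atTop (𝓝 1) := by
  have h := (tendsto_p_div_saddle hω).sub (tendsto_p_sub_q_div_saddle hω)
  rw [sub_zero] at h
  refine h.congr fun n => ?_
  ring

theorem tendsto_q_div_p : Tendsto (fun n : ℕ => (q n : ℝ) / (p n : ℝ)) atTop (𝓝 1) := by
  -- The statement involves no `ω`; any choice of saddle points allows division by the common
  -- approximation.
  choose! ω hω _ using fun n : ℕ => existsUnique_saddle (n := n)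
  have h := (tendsto_q_div_saddle hω).div (tendsto_p_div_saddle hω) one_ne_zero
  rw [div_one] at h
  refine h.congr' ?_
  filter_upwards [(tendsto_saddle hω).eventually_ge_atTop 1] with n h1
  exact div_div_div_cancel_right₀ (saddle_pos n h1).ne' _ _

end QuasiIdempotent

theorem mainTheorem8 :
    -- the series `S_m(ω)` converge absolutely
    (∀ m : ℤ, -1 ≤ m → ∀ ω : ℝ, 0 < ω → Summable (QuasiIdempotent.STerm m ω)) ∧
    -- `ω(n)` is well defined
    (∀ n : ℕ, 1 ≤ n → ∃! ω : ℝ, 0 < ω ∧ QuasiIdempotent.S 0 ω = (n : ℝ)) ∧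
    -- `q_n ∼ p_n`
    Filter.Tendsto (fun n : ℕ => (QuasiIdempotent.q n : ℝ) / (QuasiIdempotent.p n : ℝ))
      Filter.atTop (nhds 1) ∧
    -- the asymptotic formula for `q_n`
    (∀ ω : ℕ → ℝ, (∀ n : ℕ, 1 ≤ n → 0 < ω n ∧ QuasiIdempotent.S 0 (ω n) = (n : ℝ)) →
      Filter.Tendsto
        (fun n : ℕ => (QuasiIdempotent.q n : ℝ) /
          (1 / Real.sqrt (2 * Real.pi * QuasiIdempotent.S 1 (ω n)) *
            Real.exp (QuasiIdempotent.S (-1) (ω n) + (n : ℝ) / ω n)))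
        Filter.atTop (nhds 1)) := by
  exact ⟨fun _ hm _ hω => QuasiIdempotent.summable_STerm hm hω,
    fun _ hn => QuasiIdempotent.existsUnique_saddle hn,
    QuasiIdempotent.tendsto_q_div_p,
    fun _ hω => QuasiIdempotent.tendsto_q_div_saddle hω⟩
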